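/- Let $G$ be a (finite-dimensional, real, Hausdorff) Lie group with Lie algebra $\mathfrak g$ and exponential map $\exp$, let $G_X=\{g\in G:\mathrm{Ad}(g)X=X\}$ for $X\in\mathfrak g$, and let $\ell\ge 0$ be an integer. For $V=(a_1,b_1,\dots,a_k,b_k)\in G^{2k}$ put $\mathfrak m(V)=\prod_{j=1}^k a_jb_ja_j^{-1}b_j^{-1}$ and $\mathfrak r(V)=(b_k,a_k,\dots,b_1,a_1)$, and let $gVg^{-1}$ denote entrywise conjugation. Define $$X_{YM}^{k,0}=\{(V,X)\in G^{2k}\times\mathfrak g:\ V\in (G_X)^{2k},\ \mathfrak m(V)=\exp(X)\},$$ with $G$ acting by $g\cdot(V,X)=(gVg^{-1},\mathrm{Ad}(g)X)$; $$Z_{YM}^{\ell,1}=\{(V,c,\bar V,\bar c,X)\in G^{2(2\ell+1)}\times\mathfrak g:\ V,\,c\bar Vc^{-1}\in (G_X)^{2\ell},\ \mathfrak m(V)=\exp(X/2)c\bar c,\ \mathfrak m(\bar V)=\bar c\exp(-X/2)c\},$$ $$\begin{aligned}Z_{YM}^{\ell,2}=\{(V,d,c,\bar V,\bar d,\bar c,X)\in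 G^{2(2\ell+2)}\times\mathfrak g:\ & V,\,d^{-1}c\bar Vc^{-1}d\in (G_X)^{2\ell},\ d^{-1},c\bar c\in G_X,\\ & \mathfrak m(V)=\exp(X/2)c\bar dc^{-1}d,\ \mathfrak m(\bar V)=\bar cd\exp(-X/2)\bar c^{-1}\bar d\},\end{aligned}$$ with $G^2=G\times G$ acting by $$(g_1,g_2)\cdot(V,c,\bar V,\bar c,X)=(g_1Vg_1^{-1},g_1cg_2^{-1},g_2\bar Vg_2^{-1},g_2\bar cg_1^{-1},\mathrm{Ad}(g_1)X),$$ $$(g_1,g_2)\cdot(V,d,c,\bar V,\bar d,\bar c,X)=(g_1Vg_1^{-1},g_1dg_1^{-1},g_1cg_2^{-1},g_2\bar Vg_2^{-1},g_2\bar dg_2^{-1},g_2\bar cg_1^{-1},\mathrm{Ad}(g_1)X).$$ All these sets carry the subspace topology. Define $\Phi_G^{\ell,i}:Z_{YM}^{\ell,i}\to X_{YM}^{2\ell+i-1,0}$ for $i=1,2$ by $$\Phi_G^{\ell,1}(V,c,\bar V,\bar c,X)=(V,c\,\mathfrak r(\bar V)c^{-1},X),\qquad \Phi_G^{\ell,2}(V,d,c,\bar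 V,\bar d,\bar c,X)=(V,d^{-1}c\,\mathfrak r(\bar V)c^{-1}d,d^{-1},c\bar c,X).$$ Let $\Gamma_{\mathbb R}(\Sigma_0^k)$ be the group generated by $A_1,B_1,\dots,A_k,B_k$ and $J_r$ ($r\in\mathbb R$) with relations $J_rJ_s=J_{r+s}$, $[A_j,J_r]=[B_j,J_r]=1$, $\prod_{j=1}^k[A_j,B_j]=J_1$, topologized so that the cosets of $\{J_r\}$ are open with the quotient topology of $\mathbb R$; let $\mathrm{Hom}(\Gamma_{\mathbb R}(\Sigma_0^k),G)$ be the space of continuous homomorphisms with the compact-open topology, on which $G$ acts by conjugation. For a topological group $K$ and a $K$-space $M$, let $M_{hK}=EK\times_KM$ be the homotopy orbit space, with $EK=K*K*K*\cdots$ Milnor's infinite join, a functor of $K$. Then for $i=1,2$ the map $\Phi_G^{\ell,i}$ is surjective and induces a homeomorphism $$Z_{YM}^{\ell,i}/G^2\;\cong\;X_{YM}^{2\ell+i-1,0}/G;$$ there is a homeomorphism $$X_{YM}^{2\ell+i-1,0}/G\;\cong\;\mathrm{Hom}(\Gamma_{\mathbb R}(\Sigma_0^{2\ell+i-1}),G)/G$$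 that sends the class of $(V,X)$ to the class of a homomorphism $\rho$ for which $V=(\rho(A_1),\rho(B_1),\dots)$ and $\rho(J_r)=\exp(rX)$ for all $r$; and $\Phi_G^{\ell,i}$, together with the map $E(G^2)\to EG$ given by the first projection $G^2\to G$, induces a homotopy equivalence $$(Z_{YM}^{\ell,i})_{hG^2}\;\simeq\;(X_{YM}^{2\ell+i-1,0})_{hG}.$$ -/

import Mathlib

open scoped Manifold ContDiff

noncomputable section

namespace SurfaceYM

section LieTheory

variable {E : Type*} [NormedAddCommGroup E] [NormedSpace ℝ E]
  {G : Type*} [TopologicalSpace G] [Group G] [ChartedSpace E G]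

variable (E G) in
/-- The Lie algebra `𝔤` of `G`: the tangent space at the identity. -/
abbrev LieAlg : Type _ := GroupLieAlgebra 𝓘(ℝ, E) G

variable (E) in
/-- The adjoint action `Ad(g) : 𝔤 → 𝔤`, the derivative at the identity of `x ↦ g x g⁻¹`. -/
def Ad (g : G) : LieAlg E G →L[ℝ] LieAlg E G :=
  (mfderiv 𝓘(ℝ, E) 𝓘(ℝ, E) (fun x : G => g * x * g⁻¹) (1 : G) : E →L[ℝ] E)

variable (E) in
theorem Ad_one : Ad E (1 : G) = ContinuousLinearMap.id ℝ (LieAlg E G) := by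
  have h : (fun x : G => (1 : G) * x * 1⁻¹) = id := by funext x; simp
  unfold Ad
  rw [h]
  exact mfderiv_id

variable [LieGroup 𝓘(ℝ, E) ∞ G]

theorem mdiff_mul_left (g x : G) :
    MDifferentiableAt 𝓘(ℝ, E) 𝓘(ℝ, E) (fun y : G => g * y) x :=
  (contMDiff_mul_left (I := 𝓘(ℝ, E)) (n := ∞)).mdifferentiableAt (by simp)

theorem mdiff_conj (g x : G) :
    MDifferentiableAt 𝓘(ℝ, E) 𝓘(ℝ, E) (fun y : G => g * y * g⁻¹) x :=
  ((contMDiff_mul_right (I := 𝓘(ℝ, E)) (n := ∞) (a := g⁻¹)).comp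
    (contMDiff_mul_left (I := 𝓘(ℝ, E)) (n := ∞) (a := g))).mdifferentiableAt (by simp)

theorem Ad_mul_apply (g h : G) (X : LieAlg E G) : Ad E (g * h) X = Ad E g (Ad E h X) := by
  have hc : (fun x : G => (g * h) * x * (g * h)⁻¹)
      = (fun x : G => g * x * g⁻¹) ∘ (fun x : G => h * x * h⁻¹) := by
    funext x; simp [mul_assoc]
  have key : ∀ y : G, y = 1 →
      (mfderiv 𝓘(ℝ, E) 𝓘(ℝ, E) (fun x : G => g * x * g⁻¹) y : E →L[ℝ] E)
        = (mfderiv 𝓘(ℝ, E) 𝓘(ℝ, E) (fun x : G => g * x * g⁻¹) (1 : G) : E →L[ℝ] E) := by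
    rintro y rfl; rfl
  have h1 := mfderiv_comp (I := 𝓘(ℝ, E)) (I' := 𝓘(ℝ, E)) (I'' := 𝓘(ℝ, E)) (1 : G)
    (mdiff_conj (E := E) g (h * 1 * h⁻¹)) (mdiff_conj (E := E) h 1)
  rw [← hc] at h1
  have h2 := congrArg (fun L : E →L[ℝ] E => L X) h1
  refine h2.trans ?_
  exact congrArg (fun L : E →L[ℝ] E => L (Ad E h X)) (key (h * 1 * h⁻¹) (by simp))

/-- Left translations preserve left-invariant vector fields. -/
theorem mfderiv_left_invariant (X : LieAlg E G) (g h : G) :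
    mfderiv 𝓘(ℝ, E) 𝓘(ℝ, E) (fun y : G => g * y) h (mulInvariantVectorField X h)
      = (mulInvariantVectorField X (g * h) : TangentSpace 𝓘(ℝ, E) (g * h)) := by
  have hc : (fun x : G => (g * h) * x) = (fun x : G => g * x) ∘ (fun x : G => h * x) := by
    funext x; simp [mul_assoc]
  have key : ∀ y : G, y = h →
      (mfderiv 𝓘(ℝ, E) 𝓘(ℝ, E) (fun x : G => g * x) y : E →L[ℝ] E)
        = (mfderiv 𝓘(ℝ, E) 𝓘(ℝ, E) (fun x : G => g * x) h : E →L[ℝ] E) := by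
    rintro y rfl; rfl
  have h1 := mfderiv_comp (I := 𝓘(ℝ, E)) (I' := 𝓘(ℝ, E)) (I'' := 𝓘(ℝ, E)) (1 : G)
    (mdiff_mul_left (E := E) g (h * 1)) (mdiff_mul_left (E := E) h 1)
  rw [← hc] at h1
  have h2 := congrArg (fun L : E →L[ℝ] E => L X) h1
  refine Eq.trans ?_ h2.symm
  exact congrArg (fun L : E →L[ℝ] E => L (mulInvariantVectorField X h))
    (key (h * 1) (by simp)).symm

/-- Conjugation by `g` maps the left-invariant field of `X` to that of `Ad(g) X`. -/
theorem mfderiv_conj_invariant (X : LieAlg E G) (g h : G) :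
    mfderiv 𝓘(ℝ, E) 𝓘(ℝ, E) (fun y : G => g * y * g⁻¹) h (mulInvariantVectorField X h)
      = (mulInvariantVectorField (Ad E g X) (g * h * g⁻¹) :
          TangentSpace 𝓘(ℝ, E) (g * h * g⁻¹)) := by
  have hc : (fun x : G => g * x * g⁻¹) ∘ (fun x : G => h * x)
      = (fun x : G => (g * h * g⁻¹) * x) ∘ (fun x : G => g * x * g⁻¹) := by
    funext x; simp [mul_assoc]
  have key : ∀ (f : G → G) (y z : G), y = z →
      (mfderiv 𝓘(ℝ, E) 𝓘(ℝ, E) f y : E →L[ℝ] E)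
        = (mfderiv 𝓘(ℝ, E) 𝓘(ℝ, E) f z : E →L[ℝ] E) := by
    rintro f y z rfl; rfl
  have h1 := mfderiv_comp (I := 𝓘(ℝ, E)) (I' := 𝓘(ℝ, E)) (I'' := 𝓘(ℝ, E)) (1 : G)
    (mdiff_conj (E := E) g (h * 1)) (mdiff_mul_left (E := E) h 1)
  have h3 := mfderiv_comp (I := 𝓘(ℝ, E)) (I' := 𝓘(ℝ, E)) (I'' := 𝓘(ℝ, E)) (1 : G)
    (mdiff_mul_left (E := E) (g * h * g⁻¹) (g * 1 * g⁻¹)) (mdiff_conj (E := E) g 1)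
  have h2 := congrArg (fun L : E →L[ℝ] E => L X) h1
  have h4 := congrArg (fun L : E →L[ℝ] E => L X) h3
  rw [hc] at h2
  have e1 := congrArg (fun L : E →L[ℝ] E => L (mulInvariantVectorField X h))
    (key (fun y : G => g * y * g⁻¹) (h * 1) h (by simp))
  have e2 := congrArg (fun L : E →L[ℝ] E => L (Ad E g X))
    (key (fun y : G => (g * h * g⁻¹) * y) (g * 1 * g⁻¹) 1 (by simp))
  exact e1.symm.trans ((h2.symm.trans h4).trans e2)

theorem contMDiff_leftInvariant (X : LieAlg E G) :
    ContMDiff 𝓘(ℝ, E) 𝓘(ℝ, E).tangent 1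
      (fun g : G => (⟨g, mulInvariantVectorField X g⟩ : TangentBundle 𝓘(ℝ, E) G)) := by
  have : LieGroup 𝓘(ℝ, E) (minSmoothness ℝ 3) G := by
    refine LieGroup.of_le (n := ∞) ?_
    simp only [minSmoothness_of_isRCLikeNormedField]
    exact ENat.LEInfty.out
  have h := contMDiff_mulInvariantVectorField (I := 𝓘(ℝ, E)) X
  refine h.of_le ?_
  simp only [minSmoothness_of_isRCLikeNormedField]
  norm_num

theorem curve_unique [CompleteSpace E] [T2Space G] {X : LieAlg E G} {γ γ' : ℝ → G}
    (hγ : IsMIntegralCurve (I := 𝓘(ℝ, E)) γ (mulInvariantVectorField X))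
    (hγ' : IsMIntegralCurve (I := 𝓘(ℝ, E)) γ' (mulInvariantVectorField X)) {t : ℝ}
    (h : γ t = γ' t) : γ = γ' :=
  have : IsManifold 𝓘(ℝ, E) 1 G := IsManifold.of_le (n := ∞) (by simp)
  isMIntegralCurve_Ioo_eq_of_contMDiff_boundaryless (contMDiff_leftInvariant X) hγ hγ' h

theorem curve_left {X : LieAlg E G} {γ : ℝ → G} (g : G)
    (hγ : IsMIntegralCurve (I := 𝓘(ℝ, E)) γ (mulInvariantVectorField X)) :
    IsMIntegralCurve (I := 𝓘(ℝ, E)) (fun t => g * γ t) (mulInvariantVectorField X) := by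
  intro t
  have h := (mdiff_mul_left (E := E) g (γ t)).hasMFDerivAt.comp t (hγ t)
  refine h.congr_mfderiv (ContinuousLinearMap.ext fun (s : ℝ) => ?_)
  exact (ContinuousLinearMap.map_smul
      (mfderiv 𝓘(ℝ, E) 𝓘(ℝ, E) (fun y : G => g * y) (γ t) : E →L[ℝ] E)
      s (mulInvariantVectorField X (γ t))).trans
    (congrArg (fun v : E => s • v) (mfderiv_left_invariant X g (γ t)))

theorem curve_conj {X : LieAlg E G} {γ : ℝ → G} (g : G)
    (hγ : IsMIntegralCurve (I := 𝓘(ℝ, E)) γ (mulInvariantVectorField X)) :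
    IsMIntegralCurve (I := 𝓘(ℝ, E)) (fun t => g * γ t * g⁻¹)
      (mulInvariantVectorField (Ad E g X)) := by
  intro t
  have h := (mdiff_conj (E := E) g (γ t)).hasMFDerivAt.comp t (hγ t)
  refine h.congr_mfderiv (ContinuousLinearMap.ext fun (s : ℝ) => ?_)
  exact (ContinuousLinearMap.map_smul
      (mfderiv 𝓘(ℝ, E) 𝓘(ℝ, E) (fun y : G => g * y * g⁻¹) (γ t) : E →L[ℝ] E)
      s (mulInvariantVectorField X (γ t))).trans
    (congrArg (fun v : E => s • v) (mfderiv_conj_invariant X g (γ t)))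

theorem exists_curve [CompleteSpace E] [T2Space G] (X : LieAlg E G) :
    ∃ γ : ℝ → G, γ 0 = 1 ∧
      IsMIntegralCurve (I := 𝓘(ℝ, E)) γ (mulInvariantVectorField X) := by
  have hM : IsManifold 𝓘(ℝ, E) 1 G := IsManifold.of_le (n := ∞) (by simp)
  obtain ⟨γ, h0, hγ⟩ := exists_isMIntegralCurveAt_of_contMDiffAt_boundaryless (I := 𝓘(ℝ, E))
    (0 : ℝ) (contMDiff_leftInvariant X (1 : G))
  obtain ⟨ε, hε, hγ'⟩ := isMIntegralCurveAt_iff'.1 hγ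
  refine exists_isMIntegralCurve_of_isMIntegralCurveOn (contMDiff_leftInvariant X) hε ?_ 1
  intro g
  refine ⟨fun t => g * γ t, by simp [h0], ?_⟩
  intro t ht
  have ht' : t ∈ Metric.ball (0 : ℝ) ε := by
    rw [Real.ball_eq_Ioo]; simpa using ht
  have h1 := hγ' t ht'
  rw [Real.ball_eq_Ioo] at h1
  simp only [zero_sub, zero_add] at h1
  have h := (mdiff_mul_left (E := E) g (γ t)).hasMFDerivAt.comp_hasMFDerivWithinAt t h1
  refine h.congr_mfderiv (ContinuousLinearMap.ext fun (s : ℝ) => ?_)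
  exact (ContinuousLinearMap.map_smul
      (mfderiv 𝓘(ℝ, E) 𝓘(ℝ, E) (fun y : G => g * y) (γ t) : E →L[ℝ] E)
      s (mulInvariantVectorField X (γ t))).trans
    (congrArg (fun v : E => s • v) (mfderiv_left_invariant X g (γ t)))

/-- The one-parameter subgroup of `X ∈ 𝔤`: the integral curve through `1` of the left-invariant
vector field with value `X` at `1`. -/
def oneParam [CompleteSpace E] [T2Space G] (X : LieAlg E G) : ℝ → G :=
  (exists_curve X).choose

/-- The exponential map `exp : 𝔤 → G`. -/
def lieExp [CompleteSpace E] [T2Space G] (X : LieAlg E G) : G := oneParam X 1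

section
variable [CompleteSpace E] [T2Space G]

theorem oneParam_zero (X : LieAlg E G) : oneParam X 0 = 1 := (exists_curve X).choose_spec.1

theorem oneParam_curve (X : LieAlg E G) :
    IsMIntegralCurve (I := 𝓘(ℝ, E)) (oneParam X) (mulInvariantVectorField X) :=
  (exists_curve X).choose_spec.2

theorem oneParam_add (X : LieAlg E G) (s t : ℝ) :
    oneParam X (s + t) = oneParam X s * oneParam X t := by
  have h1 := (oneParam_curve X).comp_add s
  have h2 := curve_left (oneParam X s) (oneParam_curve X)
  have h := curve_unique h1 h2 (t := 0) (by simp [oneParam_zero])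
  have := congrFun h t
  simpa [add_comm] using this

theorem lieExp_smul (X : LieAlg E G) (r : ℝ) : lieExp (r • X) = oneParam X r := by
  have h1 := (oneParam_curve X).comp_mul r
  have h2 := oneParam_curve (r • X)
  have e : mulInvariantVectorField (I := 𝓘(ℝ, E)) (r • X)
      = (r • mulInvariantVectorField X : (g : G) → TangentSpace 𝓘(ℝ, E) g) :=
    mulInvariantVectorField_smul r X
  rw [e] at h2
  have h1' : IsMIntegralCurve (I := 𝓘(ℝ, E)) (oneParam X ∘ (· * r))
      (mulInvariantVectorField (r • X)) := by rw [e]; exact h1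
  have h := curve_unique h1' (oneParam_curve (r • X)) (t := 0) (by simp [oneParam_zero])
  have := congrFun h 1
  simpa [lieExp] using this.symm

theorem lieExp_add_smul (X : LieAlg E G) (s t : ℝ) :
    lieExp ((s + t) • X) = lieExp (s • X) * lieExp (t • X) := by
  simp only [lieExp_smul, oneParam_add]

theorem lieExp_half (X : LieAlg E G) :
    lieExp ((1 / 2 : ℝ) • X) * lieExp ((1 / 2 : ℝ) • X) = lieExp X := by
  rw [← lieExp_add_smul, add_halves, one_smul]

theorem lieExp_neg_half (X : LieAlg E G) :
    lieExp ((-(1 / 2) : ℝ) • X) = (lieExp ((1 / 2 : ℝ) • X))⁻¹ := by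
  rw [eq_inv_iff_mul_eq_one, ← lieExp_add_smul, neg_add_cancel, lieExp_smul, oneParam_zero]

theorem lieExp_Ad (g : G) (X : LieAlg E G) : lieExp (Ad E g X) = g * lieExp X * g⁻¹ := by
  have h1 := curve_conj g (oneParam_curve X)
  have h := curve_unique (oneParam_curve (Ad E g X)) h1 (t := 0) (by simp [oneParam_zero])
  exact congrFun h 1

end

variable (E) in
/-- `G_X`, the stabilizer of `X ∈ 𝔤` under the adjoint action. -/
def stab (X : LieAlg E G) : Subgroup G where
  carrier := {g | Ad E g X = X}
  one_mem' := by simp [Ad_one]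
  mul_mem' {a b} ha hb := by
    simp only [Set.mem_ofPred_eq] at ha hb ⊢
    rw [Ad_mul_apply, hb, ha]
  inv_mem' {a} ha := by
    simp only [Set.mem_ofPred_eq] at ha ⊢
    have h := Ad_mul_apply a⁻¹ a X
    rw [inv_mul_cancel, ha, Ad_one] at h
    exact h.symm

theorem mem_stab {X : LieAlg E G} {g : G} : g ∈ stab E X ↔ Ad E g X = X := Iff.rfl

theorem conj_mem_stab {X : LieAlg E G} {h : G} (g : G) (hh : h ∈ stab E X) :
    g * h * g⁻¹ ∈ stab E (Ad E g X) := by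
  rw [mem_stab] at hh ⊢
  rw [← Ad_mul_apply, inv_mul_cancel_right, Ad_mul_apply, hh]

theorem lieExp_comm_of_mem_stab [CompleteSpace E] [T2Space G] {X : LieAlg E G} {g : G}
    (hg : g ∈ stab E X) (r : ℝ) : g * lieExp (r • X) = lieExp (r • X) * g := by
  have h := lieExp_Ad g (r • X)
  rw [map_smul, mem_stab.1 hg] at h
  rw [h, inv_mul_cancel_right, ← h]

end LieTheory

section Tuples

variable {G : Type*} [Group G]

/-- `𝔪(a₁, b₁, …, a_ℓ, b_ℓ) = ∏ [aᵢ, bᵢ]` (in this order), for a point of `G^{2ℓ}` stored as the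
family of the pairs `(aᵢ, bᵢ)`. -/
def commProd {ℓ : ℕ} (V : Fin ℓ → G × G) : G :=
  (List.ofFn fun j => (V j).1 * (V j).2 * (V j).1⁻¹ * (V j).2⁻¹).prod

/-- `g V g⁻¹`, entrywise. -/
def conjTuple {ℓ : ℕ} (g : G) (V : Fin ℓ → G × G) : Fin ℓ → G × G :=
  fun j => (g * (V j).1 * g⁻¹, g * (V j).2 * g⁻¹)

/-- `𝔯(a₁, b₁, …, a_ℓ, b_ℓ) = (b_ℓ, a_ℓ, …, b₁, a₁)`. -/
def revTuple {ℓ : ℕ} (V : Fin ℓ → G × G) : Fin ℓ → G × G :=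
  fun j => ((V j.rev).2, (V j.rev).1)

/-- `V ∈ H^{2ℓ}`. -/
def TupleIn {ℓ : ℕ} (V : Fin ℓ → G × G) (H : Subgroup G) : Prop :=
  ∀ j, (V j).1 ∈ H ∧ (V j).2 ∈ H

theorem conjTuple_one {ℓ : ℕ} (V : Fin ℓ → G × G) : conjTuple 1 V = V := by
  funext j; simp [conjTuple]

theorem conjTuple_mul {ℓ : ℕ} (g h : G) (V : Fin ℓ → G × G) :
    conjTuple (g * h) V = conjTuple g (conjTuple h V) := by
  funext j; simp [conjTuple, mul_assoc]

theorem commProd_conj {ℓ : ℕ} (g : G) (V : Fin ℓ → G × G) :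
    commProd (conjTuple g V) = g * commProd V * g⁻¹ := by
  have h : commProd (conjTuple g V) = MulAut.conj g (commProd V) := by
    unfold commProd
    rw [map_list_prod, List.map_ofFn]
    congr 2
    funext j
    simp [conjTuple, mul_assoc]
  rw [h, MulAut.conj_apply]

theorem commProd_rev {ℓ : ℕ} (V : Fin ℓ → G × G) :
    commProd (revTuple V) = (commProd V)⁻¹ := by
  unfold commProd
  rw [List.prod_inv_reverse, List.map_ofFn]
  congr 1
  refine List.ext_getElem (by simp) fun n h1 h2 => ?_
  have e : ℓ - (n + 1) = ℓ - 1 - n := by omega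
  simp [revTuple, Fin.rev, mul_assoc, e]

theorem commProd_append {k ℓ : ℕ} (V : Fin k → G × G) (W : Fin ℓ → G × G) :
    commProd (Fin.append V W) = commProd V * commProd W := by
  unfold commProd
  rw [← List.prod_append, ← List.ofFn_fin_append]
  congr 2
  funext j
  refine Fin.addCases (fun i => ?_) (fun i => ?_) j <;> simp

theorem commProd_snoc {k : ℕ} (V : Fin k → G × G) (p : G × G) :
    commProd (Fin.snoc V p : Fin (k + 1) → G × G) = commProd V * (p.1 * p.2 * p.1⁻¹ * p.2⁻¹) := by
  unfold commProd
  rw [List.ofFn_succ']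
  simp

theorem conjTuple_append {k ℓ : ℕ} (g : G) (V : Fin k → G × G) (W : Fin ℓ → G × G) :
    conjTuple g (Fin.append V W) = Fin.append (conjTuple g V) (conjTuple g W) := by
  funext j
  refine Fin.addCases (fun i => ?_) (fun i => ?_) j <;> simp [conjTuple]

theorem TupleIn.append {k ℓ : ℕ} {V : Fin k → G × G} {W : Fin ℓ → G × G} {H : Subgroup G}
    (hV : TupleIn V H) (hW : TupleIn W H) : TupleIn (Fin.append V W) H := by
  intro j
  refine Fin.addCases (fun i => ?_) (fun i => ?_) j
  · simpa using hV i
  · simpa using hW i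

theorem TupleIn.snoc {k : ℕ} {V : Fin k → G × G} {p : G × G} {H : Subgroup G}
    (hV : TupleIn V H) (h1 : p.1 ∈ H) (h2 : p.2 ∈ H) :
    TupleIn (Fin.snoc V p : Fin (k + 1) → G × G) H := by
  intro j
  refine Fin.lastCases ?_ (fun i => ?_) j
  · simpa using ⟨h1, h2⟩
  · simpa using hV i

theorem conjTuple_rev {ℓ : ℕ} (g : G) (V : Fin ℓ → G × G) :
    conjTuple g (revTuple V) = revTuple (conjTuple g V) := rfl

theorem TupleIn.rev {ℓ : ℕ} {V : Fin ℓ → G × G} {H : Subgroup G} (hV : TupleIn V H) :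
    TupleIn (revTuple V) H := fun j => ⟨(hV j.rev).2, (hV j.rev).1⟩

theorem TupleIn.commProd_mem {ℓ : ℕ} {V : Fin ℓ → G × G} {H : Subgroup G} (hV : TupleIn V H) :
    commProd V ∈ H := by
  refine Subgroup.list_prod_mem _ fun x hx => ?_
  obtain ⟨j, rfl⟩ := (List.mem_ofFn' _ _).1 hx
  exact mul_mem (mul_mem (mul_mem (hV j).1 (hV j).2) (inv_mem (hV j).1)) (inv_mem (hV j).2)

end Tuples

section

variable {E : Type*} [NormedAddCommGroup E] [NormedSpace ℝ E]
  {G : Type*} [TopologicalSpace G] [Group G] [ChartedSpace E G] [LieGroup 𝓘(ℝ, E) ∞ G]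

theorem TupleIn.conj {ℓ : ℕ} {V : Fin ℓ → G × G} {X : LieAlg E G} (g : G)
    (hV : TupleIn V (stab E X)) : TupleIn (conjTuple g V) (stab E (Ad E g X)) :=
  fun j => ⟨conj_mem_stab g (hV j).1, conj_mem_stab g (hV j).2⟩

end

section Varieties

variable (E : Type*) [NormedAddCommGroup E] [NormedSpace ℝ E] [CompleteSpace E]
  (G : Type*) [TopologicalSpace G] [T2Space G] [Group G] [ChartedSpace E G]
  [LieGroup 𝓘(ℝ, E) ∞ G]

/-- The representation variety `X_YM^{k,0} ⊆ G^{2k} × 𝔤` of the closed orientable surface of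
genus `k`. -/
def ymVariety (k : ℕ) : Set ((Fin k → G × G) × LieAlg E G) :=
  {p | TupleIn p.1 (stab E p.2) ∧ commProd p.1 = lieExp p.2}

/-- The symmetric representation variety `Z_YM^{ℓ,1}`, whose points are the tuples
`(V, c, V̄, c̄, X)`. -/
def zymVariety₁ (ℓ : ℕ) :
    Set ((Fin ℓ → G × G) × G × (Fin ℓ → G × G) × G × LieAlg E G) :=
  {p | match p with
    | (V, c, V', c', X) =>
      TupleIn V (stab E X) ∧ TupleIn (conjTuple c V') (stab E X) ∧
      commProd V = lieExp ((1 / 2 : ℝ) • X) * c * c' ∧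
      commProd V' = c' * lieExp ((-(1 / 2) : ℝ) • X) * c}

/-- The symmetric representation variety `Z_YM^{ℓ,2}`, whose points are the tuples
`(V, d, c, V̄, d̄, c̄, X)`. -/
def zymVariety₂ (ℓ : ℕ) :
    Set ((Fin ℓ → G × G) × G × G × (Fin ℓ → G × G) × G × G × LieAlg E G) :=
  {p | match p with
    | (V, d, c, V', d', c', X) =>
      TupleIn V (stab E X) ∧ TupleIn (conjTuple (d⁻¹ * c) V') (stab E X) ∧
      d⁻¹ ∈ stab E X ∧ c * c' ∈ stab E X ∧
      commProd V = lieExp ((1 / 2 : ℝ) • X) * c * d' * c⁻¹ * d ∧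
      commProd V' = c' * d * lieExp ((-(1 / 2) : ℝ) • X) * c'⁻¹ * d'}

variable {E G}

/-- `G` acts on `X_YM^{k,0}` by `g · (V, X) = (g V g⁻¹, Ad(g) X)`. -/
instance (k : ℕ) : MulAction G (ymVariety E G k) where
  smul g p := ⟨(conjTuple g p.1.1, Ad E g p.1.2), p.2.1.conj g, by
    rw [commProd_conj, lieExp_Ad, p.2.2]⟩
  one_smul p := Subtype.ext (Prod.ext (conjTuple_one _) (by
    change Ad E 1 p.1.2 = p.1.2
    rw [Ad_one]; rfl))
  mul_smul g h p := Subtype.ext (Prod.ext (conjTuple_mul _ _ _) (Ad_mul_apply _ _ _))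

/-- `G × G` acts on `Z_YM^{ℓ,1}` by
`(g₁, g₂) · (V, c, V̄, c̄, X) = (g₁ V g₁⁻¹, g₁ c g₂⁻¹, g₂ V̄ g₂⁻¹, g₂ c̄ g₁⁻¹, Ad(g₁) X)`. -/
instance (ℓ : ℕ) : MulAction (G × G) (zymVariety₁ E G ℓ) where
  smul g p := match p with
    | ⟨(V, c, V', c', X), h⟩ =>
      ⟨(conjTuple g.1 V, g.1 * c * g.2⁻¹, conjTuple g.2 V', g.2 * c' * g.1⁻¹, Ad E g.1 X), by
        obtain ⟨h1, h2, h3, h4⟩ := h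
        refine ⟨h1.conj g.1, ?_, ?_, ?_⟩
        · have := h2.conj g.1
          rw [← conjTuple_mul] at this ⊢
          rwa [inv_mul_cancel_right]
        · rw [commProd_conj, h3, ← map_smul, lieExp_Ad]; group
        · rw [commProd_conj, h4, ← map_smul, lieExp_Ad]; group⟩
  one_smul := by
    rintro ⟨⟨V, c, V', c', X⟩, h⟩
    apply Subtype.ext
    change (conjTuple 1 V, 1 * c * 1⁻¹, conjTuple 1 V', 1 * c' * 1⁻¹, Ad E 1 X) = _
    simp [conjTuple_one, Ad_one]
  mul_smul := by
    rintro ⟨g, g'⟩ ⟨h, h'⟩ ⟨⟨V, c, V', c', X⟩, hp⟩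
    apply Subtype.ext
    change (conjTuple (g * h) V, (g * h) * c * (g' * h')⁻¹, conjTuple (g' * h') V',
      (g' * h') * c' * (g * h)⁻¹, Ad E (g * h) X) =
      (conjTuple g (conjTuple h V), g * (h * c * h'⁻¹) * g'⁻¹, conjTuple g' (conjTuple h' V'),
        g' * (h' * c' * h⁻¹) * g⁻¹, Ad E g (Ad E h X))
    simp [conjTuple_mul, Ad_mul_apply, mul_assoc]

/-- `G × G` acts on `Z_YM^{ℓ,2}` by `(g₁, g₂) · (V, d, c, V̄, d̄, c̄, X) =
(g₁ V g₁⁻¹, g₁ d g₁⁻¹, g₁ c g₂⁻¹, g₂ V̄ g₂⁻¹, g₂ d̄ g₂⁻¹, g₂ c̄ g₁⁻¹, Ad(g₁) X)`. -/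
instance (ℓ : ℕ) : MulAction (G × G) (zymVariety₂ E G ℓ) where
  smul g p := match p with
    | ⟨(V, d, c, V', d', c', X), h⟩ =>
      ⟨(conjTuple g.1 V, g.1 * d * g.1⁻¹, g.1 * c * g.2⁻¹, conjTuple g.2 V', g.2 * d' * g.2⁻¹,
          g.2 * c' * g.1⁻¹, Ad E g.1 X), by
        obtain ⟨h1, h2, h3, h4, h5, h6⟩ := h
        refine ⟨h1.conj g.1, ?_, ?_, ?_, ?_, ?_⟩
        · have := h2.conj g.1
          rw [← conjTuple_mul] at this ⊢
          convert this using 2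
          group
        · have := conj_mem_stab g.1 h3
          convert this using 1
          group
        · have := conj_mem_stab g.1 h4
          convert this using 1
          group
        · rw [commProd_conj, h5, ← map_smul, lieExp_Ad]; group
        · rw [commProd_conj, h6, ← map_smul, lieExp_Ad]; group⟩
  one_smul := by
    rintro ⟨⟨V, d, c, V', d', c', X⟩, h⟩
    apply Subtype.ext
    change (conjTuple 1 V, 1 * d * 1⁻¹, 1 * c * 1⁻¹, conjTuple 1 V', 1 * d' * 1⁻¹,
      1 * c' * 1⁻¹, Ad E 1 X) = _
    simp [conjTuple_one, Ad_one]
  mul_smul := by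
    rintro ⟨g, g'⟩ ⟨h, h'⟩ ⟨⟨V, d, c, V', d', c', X⟩, hp⟩
    apply Subtype.ext
    change (conjTuple (g * h) V, (g * h) * d * (g * h)⁻¹, (g * h) * c * (g' * h')⁻¹,
      conjTuple (g' * h') V', (g' * h') * d' * (g' * h')⁻¹,
      (g' * h') * c' * (g * h)⁻¹, Ad E (g * h) X) =
      (conjTuple g (conjTuple h V), g * (h * d * h⁻¹) * g⁻¹, g * (h * c * h'⁻¹) * g'⁻¹,
        conjTuple g' (conjTuple h' V'), g' * (h' * d' * h'⁻¹) * g'⁻¹,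
        g' * (h' * c' * h⁻¹) * g⁻¹, Ad E g (Ad E h X))
    simp [conjTuple_mul, Ad_mul_apply, mul_assoc]

/-- `Φ^{ℓ,1}(V, c, V̄, c̄, X) = (V, c 𝔯(V̄) c⁻¹, X)`, as a map `Z_YM^{ℓ,1} → X_YM^{2ℓ,0}`. -/
def Phi₁ (ℓ : ℕ) (p : zymVariety₁ E G ℓ) : ymVariety E G (ℓ + ℓ) :=
  match p with
  | ⟨(V, c, V', c', X), h⟩ =>
    ⟨(Fin.append V (conjTuple c (revTuple V')), X), by
      obtain ⟨h1, h2, h3, h4⟩ := h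
      refine ⟨h1.append h2.rev, ?_⟩
      have hm := lieExp_comm_of_mem_stab h1.commProd_mem (1 / 2 : ℝ)
      change commProd (Fin.append V (conjTuple c (revTuple V'))) = lieExp X
      rw [commProd_append, commProd_conj, commProd_rev, h4, lieExp_neg_half, ← lieExp_half X]
      generalize lieExp ((1 / 2 : ℝ) • X) = a at *
      have hc : c * c' = a⁻¹ * commProd V := by rw [h3]; group
      generalize commProd V = m at *
      obtain rfl : c' = c⁻¹ * (a⁻¹ * m) := by rw [← hc]; group
      calc m * (c * (c⁻¹ * (a⁻¹ * m) * a⁻¹ * c)⁻¹ * c⁻¹) = (m * a) * m⁻¹ * a := by group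
        _ = a * a := by rw [hm]; group⟩

/-- `Φ^{ℓ,2}(V, d, c, V̄, d̄, c̄, X) = (V, d⁻¹c 𝔯(V̄) c⁻¹d, d⁻¹, c c̄, X)`, as a map
`Z_YM^{ℓ,2} → X_YM^{2ℓ+1,0}`. -/
def Phi₂ (ℓ : ℕ) (p : zymVariety₂ E G ℓ) : ymVariety E G (ℓ + ℓ + 1) :=
  match p with
  | ⟨(V, d, c, V', d', c', X), h⟩ =>
    ⟨(Fin.snoc (Fin.append V (conjTuple (d⁻¹ * c) (revTuple V'))) (d⁻¹, c * c'), X), by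
      obtain ⟨h1, h2, h3, h4, h5, h6⟩ := h
      refine ⟨(h1.append h2.rev).snoc h3 h4, ?_⟩
      have hm := lieExp_comm_of_mem_stab h4 (1 / 2 : ℝ)
      change commProd (Fin.snoc (Fin.append V (conjTuple (d⁻¹ * c) (revTuple V')))
        (d⁻¹, c * c') : Fin (ℓ + ℓ + 1) → G × G) = lieExp X
      rw [commProd_snoc, commProd_append, commProd_conj, commProd_rev, h5, h6, lieExp_neg_half,
        ← lieExp_half X]
      generalize lieExp ((1 / 2 : ℝ) • X) = a at *
      calc _ = a * ((c * c') * a) * (c * c')⁻¹ := by group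
        _ = a * a := by rw [hm]; group⟩

end Varieties

section Homs

/-- Generators `A₁, B₁, …, A_k, B_k` and `J_r`, `r ∈ ℝ`. -/
inductive SurfGen (k : ℕ) : Type
  | A (j : Fin k) : SurfGen k
  | B (j : Fin k) : SurfGen k
  | J (r : ℝ) : SurfGen k

/-- The relations `J_r J_s = J_{r+s}`, `[A_j, J_r] = [B_j, J_r] = 1` and
`∏ [A_j, B_j] = J_1`, as words that are declared trivial. -/
def surfRels (k : ℕ) : Set (FreeGroup (SurfGen k)) :=
  {w | (∃ r s : ℝ, w = .of (.J r) * .of (.J s) * (.of (.J (r + s)))⁻¹) ∨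
    (∃ (j : Fin k) (r : ℝ), w = .of (.A j) * .of (.J r) * (.of (.A j))⁻¹ * (.of (.J r))⁻¹) ∨
    (∃ (j : Fin k) (r : ℝ), w = .of (.B j) * .of (.J r) * (.of (.B j))⁻¹ * (.of (.J r))⁻¹) ∨
    w = commProd (fun j : Fin k => (FreeGroup.of (SurfGen.A j), FreeGroup.of (SurfGen.B j))) *
      (.of (.J 1))⁻¹}

/-- The group `Γ_ℝ(Σ)` of the closed orientable surface `Σ` of genus `k`. -/
def SurfGamma (k : ℕ) : Type := PresentedGroup (surfRels k)

instance (k : ℕ) : Group (SurfGamma k) := inferInstanceAs (Group (PresentedGroup (surfRels k)))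

/-- The image of a generator in `Γ_ℝ(Σ)`. -/
def SurfGamma.of {k : ℕ} (x : SurfGen k) : SurfGamma k := PresentedGroup.of x

/-- The Lie group topology of `Γ_ℝ(Σ)`, an extension of a discrete group by a quotient of `ℝ`:
the finest topology for which all the maps `r ↦ J_r x` are continuous, so that the cosets of
`{J_r}` are open and carry the quotient topology of `ℝ`. -/
instance (k : ℕ) : TopologicalSpace (SurfGamma k) :=
  ⨆ x : SurfGamma k, TopologicalSpace.coinduced (fun r : ℝ => SurfGamma.of (.J r) * x) inferInstance

/-- `Hom(Γ_ℝ(Σ), G)`: the continuous homomorphisms, with the compact-open topology. -/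
abbrev SurfHom (k : ℕ) (G : Type*) [TopologicalSpace G] [Group G] : Type _ := SurfGamma k →ₜ* G

/-- `G` acts on `Hom(Γ_ℝ(Σ), G)` by conjugation, `(g · ρ)(x) = g ρ(x) g⁻¹`. -/
instance (k : ℕ) (G : Type*) [TopologicalSpace G] [Group G] [IsTopologicalGroup G] :
    MulAction G (SurfHom k G) where
  smul g ρ :=
    { toMonoidHom := (MulAut.conj g).toMonoidHom.comp ρ.toMonoidHom
      continuous_toFun :=
        (IsTopologicalGroup.continuous_conj g).comp ρ.continuous_toFun }
  one_smul ρ := by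
    ext x
    change 1 * ρ x * 1⁻¹ = ρ x
    simp
  mul_smul g h ρ := by
    ext x
    change (g * h) * ρ x * (g * h)⁻¹ = g * (h * ρ x * h⁻¹) * g⁻¹
    simp [mul_assoc]

/-- `ρ ∈ Hom(Γ_ℝ(Σ), G)` corresponds to `(V, X) ∈ X_YM^{k,0}`: the entries of `V` are
`ρ(A_j), ρ(B_j)`, and `ρ(J_r) = exp(r X)`. -/
def Corresponds {E : Type*} [NormedAddCommGroup E] [NormedSpace ℝ E] [CompleteSpace E]
    {G : Type*} [TopologicalSpace G] [T2Space G] [Group G] [ChartedSpace E G]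
    [LieGroup 𝓘(ℝ, E) ∞ G] {k : ℕ} (x : ymVariety E G k) (ρ : SurfHom k G) : Prop :=
  (∀ j, ρ (.of (.A j)) = (x.1.1 j).1 ∧ ρ (.of (.B j)) = (x.1.1 j).2) ∧
    ∀ r : ℝ, ρ (.of (.J r)) = lieExp (r • x.1.2)

end Homs

section HomotopyOrbits

/-- Milnor's total space `EK = K * K * K * ⋯`, the infinite join of copies of `K`: a point is a
finitely supported family of barycentric coordinates `t i ≥ 0` of sum `1`, together with an element
`g i` of `K` for each `i` with `t i ≠ 0` (and `none` for the other `i`). -/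
@[ext]
structure MilnorE (K : Type*) where
  t : ℕ →₀ ℝ
  g : ℕ → Option K
  nonneg : ∀ i, 0 ≤ t i
  sum_eq : t.sum (fun _ x => x) = 1
  isSome_iff : ∀ i, (g i).isSome ↔ t i ≠ 0

/-- The coarsest topology for which all coordinates `t i : EK → ℝ` and `g i : {t i ≠ 0} → K` are
continuous, the sets `{t i ≠ 0}` being open. -/
instance (K : Type*) [TopologicalSpace K] : TopologicalSpace (MilnorE K) :=
  TopologicalSpace.generateFrom
    ({S | ∃ (i : ℕ) (U : Set ℝ), IsOpen U ∧ S = {e | e.t i ∈ U}} ∪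
      {S | ∃ (i : ℕ) (U : Set K), IsOpen U ∧ S = {e | ∃ x ∈ U, e.g i = some x}})

/-- `K` acts on `EK` by translation of all the `K`-coordinates. -/
instance (K : Type*) [Group K] : MulAction K (MilnorE K) where
  smul k e := ⟨e.t, fun i => (e.g i).map (k * ·), e.nonneg, e.sum_eq, fun i => by
    simpa using e.isSome_iff i⟩
  one_smul e := by
    refine MilnorE.ext rfl (funext fun i => ?_)
    change (e.g i).map (1 * ·) = e.g i
    simp
  mul_smul a b e := by
    refine MilnorE.ext rfl (funext fun i => ?_)
    change (e.g i).map (a * b * ·) = ((e.g i).map (b * ·)).map (a * ·)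
    simp [Function.comp_def, mul_assoc]

/-- The map `EK → EL` induced by a map `K → L`. -/
def MilnorE.map {K L : Type*} (f : K → L) (e : MilnorE K) : MilnorE L :=
  ⟨e.t, fun i => (e.g i).map f, e.nonneg, e.sum_eq, fun i => by simpa using e.isSome_iff i⟩

/-- The homotopy orbit space `M_{hK} = EK ×_K M`, the orbit space of the diagonal action of `K` on
`EK × M`. -/
abbrev HomotopyOrbit (K M : Type*) [Group K] [MulAction K M] : Type _ :=
  MulAction.orbitRel.Quotient K (MilnorE K × M)

/-- The class `[e, m]` in the homotopy orbit space. -/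
def HomotopyOrbit.mk {K M : Type*} [Group K] [MulAction K M] (e : MilnorE K) (m : M) :
    HomotopyOrbit K M := Quotient.mk _ (e, m)

end HomotopyOrbits

end SurfaceYM

end

open SurfaceYM

/-! For either value of i the map Φ has a continuous section s, normalized by c = 1, which satisfies
s(g·x) = (g, g)·s(x) and z = (1, c⁻¹)·s(Φ z) for every z in Z. Indeed the second factor of G² can
always bring c to 1, and then Φ z and the first product equation determine all other coordinates. So
Z is the G²-space induced from the G-space X along the diagonal. Surjectivity and the homeomorphism
of orbit spaces follow formally (`exists_orbit_homeomorph`); the algebra is in `section₁`,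
`section₂`, `eq_smul_section₁` and `eq_smul_section₂`.

For homotopy orbits, Φ is paired with the first projection and s with the diagonal δ. One composite
is the identity. The other sends the class of (e, z) to that of (δ(pr₁ e), s(Φ z)), whereas (e, z)
itself is equivalent to ((1, c)·e, s(Φ z)). It remains to deform two self-maps of E(G²), the
identity and the map induced by δ ∘ pr₁, into each other compatibly with the diagonal G. In Milnor's
join both can be deformed to the map that pushes every coordinate one place on (`MilnorE.shift`), so
no theory of principal bundles is needed (`exists_homotopyEquiv`).

The comparison with Hom(Γ_ℝ, G) sends ρ to (ρ(A_j), ρ(B_j), X), where X generates the one-parameter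
subgroup r ↦ ρ(J_r). One needs X to exist, to be unique and to depend continuously on ρ. All this
rests on exp being a local homeomorphism at 0: a Gronwall estimate shows that exp, read in a chart,
is strictly differentiable at 0 with derivative the identity (`hasStrictFDerivAt_chart_exp`), and
then X = ε⁻¹ log ρ(J_ε) for small ε (`eq_flow_of_mem`). Conversely ρ depends continuously on (V, X)
because near any y the group Γ_ℝ consists of the elements J_r y with r small (`continuous_ymHom`).
-/

noncomputable section

namespace SurfaceYM

/-! ### Milnor's infinite join: topology, action and functoriality -/

namespace MilnorE

section Topology

variable {K : Type*} [TopologicalSpace K] {Y : Type*} [TopologicalSpace Y]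

theorem continuous_iff {f : Y → MilnorE K} :
    Continuous f ↔ (∀ i, Continuous fun y => (f y).t i) ∧
      ∀ (i : ℕ) (U : Set K), IsOpen U → IsOpen {y | ∃ x ∈ U, (f y).g i = some x} := by
  constructor
  · intro hf
    refine ⟨fun i => continuous_def.2 fun U hU => ?_, fun i U hU => ?_⟩
    · exact (TopologicalSpace.isOpen_generateFrom_of_mem (Or.inl ⟨i, U, hU, rfl⟩)).preimage hf
    · exact (TopologicalSpace.isOpen_generateFrom_of_mem (Or.inr ⟨i, U, hU, rfl⟩)).preimage hf
  · rintro ⟨h1, h2⟩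
    refine continuous_generateFrom_iff.2 ?_
    rintro _ (⟨i, U, hU, rfl⟩ | ⟨i, U, hU, rfl⟩)
    · exact hU.preimage (h1 i)
    · exact h2 i U hU

theorem continuous_t (i : ℕ) : Continuous fun e : MilnorE K => e.t i :=
  (continuous_iff.1 continuous_id).1 i

/-- An open condition on a point and on the `i`-th group coordinate is open. -/
theorem isOpen_coord {f : Y → MilnorE K} (hf : Continuous f) (i : ℕ) {W : Set (Y × K)}
    (hW : IsOpen W) : IsOpen {y | ∃ x, (f y).g i = some x ∧ (y, x) ∈ W} := by
  rw [isOpen_iff_mem_nhds]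
  rintro y ⟨x, hx, hyx⟩
  obtain ⟨A, B, hA, hB, hyA, hxB, hAB⟩ := isOpen_prod_iff.1 hW y x hyx
  have h := (hA.inter ((continuous_iff.1 hf).2 i B hB)).mem_nhds ⟨hyA, x, hxB, hx⟩
  filter_upwards [h]
  rintro z ⟨hz, x', hx', e⟩
  exact ⟨x', e, hAB ⟨hz, hx'⟩⟩

end Topology

section Action

variable {K : Type*} [Group K]

theorem smul_t (k : K) (e : MilnorE K) : (k • e).t = e.t := rfl

theorem smul_g (k : K) (e : MilnorE K) (i : ℕ) : (k • e).g i = (e.g i).map (k * ·) := rfl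

instance [TopologicalSpace K] [IsTopologicalGroup K] : ContinuousSMul K (MilnorE K) := by
  refine ⟨continuous_iff.2 ⟨fun i => ?_, fun i U hU => ?_⟩⟩
  · simp only [smul_t]
    exact (continuous_t i).comp continuous_snd
  · have h := isOpen_coord (f := fun p : K × MilnorE K => p.2) continuous_snd i
      (W := {q | q.1.1 * q.2 ∈ U}) (hU.preimage (by fun_prop))
    convert h using 1
    ext ⟨k, e⟩
    simp only [smul_g, Set.mem_ofPred_eq, Option.map_eq_some_iff]
    constructor
    · rintro ⟨_, hx, y, hy, rfl⟩; exact ⟨y, hy, hx⟩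
    · rintro ⟨y, hy, hx⟩; exact ⟨_, hx, y, hy, rfl⟩

end Action

section Map

variable {K L : Type*}

theorem map_t (f : K → L) (e : MilnorE K) : (e.map f).t = e.t := rfl

theorem map_g (f : K → L) (e : MilnorE K) (i : ℕ) : (e.map f).g i = (e.g i).map f := rfl

theorem map_id (e : MilnorE K) : e.map id = e :=
  MilnorE.ext rfl (funext fun i => by simp [map_g])

theorem map_map {M : Type*} (f : K → L) (f' : L → M) (e : MilnorE K) :
    (e.map f).map f' = e.map (f' ∘ f) :=
  MilnorE.ext rfl (funext fun i => by simp [map_g])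

theorem map_smul [Group K] [Group L] (f : K → L) (k : K) (l : L) (h : ∀ x, f (k * x) = l * f x)
    (e : MilnorE K) : (k • e).map f = l • e.map f :=
  MilnorE.ext rfl (funext fun i => by simp [map_g, smul_g, Function.comp_def, h])

theorem continuous_map [TopologicalSpace K] [TopologicalSpace L] {f : K → L} (hf : Continuous f) :
    Continuous (MilnorE.map f) := by
  refine continuous_iff.2 ⟨fun i => continuous_t i, fun i U hU => ?_⟩
  have h := (continuous_iff.1 (continuous_id (X := MilnorE K))).2 i _ (hU.preimage hf)
  convert h using 1
  ext e
  simp only [map_g, Set.mem_ofPred_eq, Option.map_eq_some_iff]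
  constructor
  · rintro ⟨_, hx, y, hy, rfl⟩; exact ⟨y, hx, hy⟩
  · rintro ⟨y, hx, hy⟩; exact ⟨_, hx, y, hy, rfl⟩

end Map

/-! ### Shifting the coordinates of the infinite join -/

section Shift

/-- The part of the `n`-th barycentric coordinate that has not yet been moved at time `s`. -/
def weight (n : ℕ) (s : ℝ) : ℝ := max 0 (min 1 ((n + 2) * (1 - (n + 1) * s)))

theorem weight_nonneg (n : ℕ) (s : ℝ) : 0 ≤ weight n s := le_max_left _ _

theorem weight_le_one (n : ℕ) (s : ℝ) : weight n s ≤ 1 :=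
  max_le zero_le_one (min_le_left _ _)

theorem continuous_weight (n : ℕ) : Continuous (weight n) := by
  unfold weight; fun_prop

theorem weight_zero (n : ℕ) : weight n 0 = 1 := by
  have h : (1 : ℝ) ≤ n + 2 := by have := n.cast_nonneg (α := ℝ); linarith
  simp [weight, h]

theorem weight_one (n : ℕ) : weight n 1 = 0 := by
  have h : ((n : ℝ) + 2) * (1 - (n + 1) * 1) ≤ 0 := by
    have := n.cast_nonneg (α := ℝ); nlinarith
  exact max_eq_left ((min_le_right _ _).trans h)

/-- The weight n falls from 1 to 0 on [1/(n+2), 1/(n+1)], and the weight n+1 has already vanished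
when this interval begins: if (n+2)s < 1, then (n+2)(1 - (n+1)s) > (n+2) - (n+1) = 1. -/
theorem weight_eq_one {n : ℕ} {s : ℝ} (h : weight (n + 1) s ≠ 0) : weight n s = 1 := by
  have hn := n.cast_nonneg (α := ℝ)
  have h1 : 0 < 1 - ((n : ℝ) + 1 + 1) * s := by
    by_contra! hc
    refine h (max_eq_left ((min_le_right _ _).trans ?_))
    push_cast
    exact mul_nonpos_of_nonneg_of_nonpos (by linarith) hc
  have h2 : (1 : ℝ) ≤ (n + 2) * (1 - (n + 1) * s) := by nlinarith
  simp [weight, min_eq_left h2]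

variable {K L : Type*}

/-- The mass that remains in its place at time `s`. -/
def stay (s : ℝ) (e : MilnorE K) : ℕ →₀ ℝ :=
  Finsupp.onFinset e.t.support (fun n => weight n s * e.t n) fun n hn => by
    simpa using right_ne_zero_of_mul hn

/-- The mass that has been moved on at time `s`. -/
def moved (s : ℝ) (e : MilnorE K) : ℕ →₀ ℝ :=
  Finsupp.onFinset e.t.support (fun n => (1 - weight n s) * e.t n) fun n hn => by
    simpa using right_ne_zero_of_mul hn

theorem stay_apply (s : ℝ) (e : MilnorE K) (n : ℕ) : stay s e n = weight n s * e.t n := rfl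

theorem moved_apply (s : ℝ) (e : MilnorE K) (n : ℕ) :
    moved s e n = (1 - weight n s) * e.t n := rfl

theorem stay_nonneg (s : ℝ) (e : MilnorE K) (n : ℕ) : 0 ≤ stay s e n :=
  mul_nonneg (weight_nonneg n s) (e.nonneg n)

theorem moved_nonneg (s : ℝ) (e : MilnorE K) (n : ℕ) : 0 ≤ moved s e n :=
  mul_nonneg (sub_nonneg.2 (weight_le_one n s)) (e.nonneg n)

/-- At any time at most one of the masses that stay in the place n + 1 and arrive there from n is
nonzero. Hence two group elements never compete for one place, and `shiftCoord` is consistent. -/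
theorem moved_eq_zero {s : ℝ} {e : MilnorE K} {n : ℕ} (h : stay s e (n + 1) ≠ 0) :
    moved s e n = 0 := by
  rw [moved_apply, weight_eq_one (left_ne_zero_of_mul h), sub_self, zero_mul]

/-- The group coordinates of `shift`. -/
def shiftCoord (v v' : K → L) (s : ℝ) (e : MilnorE K) : ℕ → Option L
  | 0 => if stay s e 0 = 0 then none else (e.g 0).map v
  | n + 1 => if stay s e (n + 1) = 0 then (if moved s e n = 0 then none else (e.g n).map v')
      else (e.g (n + 1)).map v

/-- A homotopy from `MilnorE.map v` to the map that applies `v'` to all group coordinates and moves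
the `n`-th coordinates to the place `n + 1`. For each `n` the mass in the place `n` is moved
during the time interval `[1 / (n + 2), 1 / (n + 1)]`, when the place `n + 1` is already empty. -/
def shift (v v' : K → L) (s : ℝ) (e : MilnorE K) : MilnorE L where
  t := stay s e + (moved s e).mapDomain (· + 1)
  g := shiftCoord v v' s e
  nonneg n := by
    rw [Finsupp.add_apply]
    refine add_nonneg (stay_nonneg s e n) ?_
    cases n with
    | zero => rw [Finsupp.mapDomain_of_notMem_range _ _ (by simp)]
    | succ n =>
      rw [Finsupp.mapDomain_apply (add_left_injective 1)]
      exact moved_nonneg s e n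
  sum_eq := by
    rw [Finsupp.sum_add_index' (fun _ => rfl) (fun _ _ _ => rfl),
      Finsupp.sum_mapDomain_index (fun _ => rfl) (fun _ _ _ => rfl), stay, moved,
      Finsupp.onFinset_sum _ (fun _ => rfl), Finsupp.onFinset_sum _ (fun _ => rfl),
      ← Finset.sum_add_distrib]
    refine Eq.trans ?_ e.sum_eq
    exact Finset.sum_congr rfl fun n _ => by ring
  isSome_iff n := by
    rw [Finsupp.add_apply]
    cases n with
    | zero =>
      rw [Finsupp.mapDomain_of_notMem_range _ _ (by simp), add_zero, shiftCoord]
      split_ifs with h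
      · simp [h]
      · simpa [h] using (e.isSome_iff 0).2 (right_ne_zero_of_mul h)
    | succ n =>
      rw [Finsupp.mapDomain_apply (add_left_injective 1), shiftCoord]
      split_ifs with h h'
      · simp [h, h']
      · simpa [h, h'] using (e.isSome_iff n).2 (right_ne_zero_of_mul h')
      · rw [moved_eq_zero h, add_zero]
        simpa [h] using (e.isSome_iff (n + 1)).2 (right_ne_zero_of_mul h)

theorem shift_zero (v v' : K → L) (e : MilnorE K) : shift v v' 0 e = e.map v := by
  have h1 : stay 0 e = e.t := by ext n; simp [stay_apply, weight_zero]
  have h2 : moved 0 e = 0 := by ext n; simp [moved_apply, weight_zero]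
  -- Where the barycentric coordinate vanishes, `shiftCoord` gives `none` by definition; the
  -- original point has `none` there too.
  have h3 : ∀ n, e.t n = 0 → e.g n = none := fun n hn => by
    rw [← Option.not_isSome_iff_eq_none, e.isSome_iff]; simpa using hn
  refine MilnorE.ext ?_ (funext fun n => ?_)
  · simp [shift, h1, h2, map_t]
  · cases n with
    | zero =>
      change shiftCoord v v' 0 e 0 = _
      rw [shiftCoord, h1, map_g]
      split_ifs with h <;> simp_all
    | succ n =>
      change shiftCoord v v' 0 e (n + 1) = _
      rw [shiftCoord, h1, h2, map_g]
      split_ifs with h h' <;> simp_all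

/-- At time 1 no mass is left in its old place, so v no longer enters. This common endpoint is what
joins the maps induced by two different v. -/
theorem shift_one (v₁ v₂ v' : K → L) (e : MilnorE K) : shift v₁ v' 1 e = shift v₂ v' 1 e := by
  have h1 : stay 1 e = 0 := by ext n; simp [stay_apply, weight_one]
  refine MilnorE.ext rfl (funext fun n => ?_)
  change shiftCoord _ _ _ _ _ = shiftCoord _ _ _ _ _
  cases n <;> simp [shiftCoord, h1]

theorem shift_smul [Group K] [Group L] {v v' : K → L} {k : K} {l : L}
    (h : ∀ x, v (k * x) = l * v x) (h' : ∀ x, v' (k * x) = l * v' x) (s : ℝ) (e : MilnorE K) :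
    shift v v' s (k • e) = l • shift v v' s e := by
  refine MilnorE.ext rfl (funext fun n => ?_)
  rw [smul_g]
  change shiftCoord v v' s (k • e) n = (shiftCoord v v' s e n).map _
  have h1 : stay s (k • e) = stay s e := rfl
  have h2 : moved s (k • e) = moved s e := rfl
  cases n <;> simp only [shiftCoord, h1, h2, smul_g] <;> split_ifs <;>
    simp [Function.comp_def, h, h']

/-- The topology is tested on one place at a time. The place n + 1 carries a group element in a
given open set exactly on a union of two open sets: one where mass stays there, one where mass
arrives from n. Although infinitely many moves accumulate at time 0, each coordinate sees only two
of them. -/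
theorem continuous_shift [TopologicalSpace K] [TopologicalSpace L] {v v' : K → L}
    (hv : Continuous v) (hv' : Continuous v') :
    Continuous fun p : ℝ × MilnorE K => shift v v' p.1 p.2 := by
  have hs (n : ℕ) : Continuous fun p : ℝ × MilnorE K => stay p.1 p.2 n := by
    simp only [stay_apply]
    exact ((continuous_weight n).comp continuous_fst).mul ((continuous_t n).comp continuous_snd)
  have hm (n : ℕ) : Continuous fun p : ℝ × MilnorE K => moved p.1 p.2 n := by
    simp only [moved_apply]
    exact (continuous_const.sub ((continuous_weight n).comp continuous_fst)).mul
      ((continuous_t n).comp continuous_snd)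
  have hne {f : ℝ × MilnorE K → ℝ} (hf : Continuous f) : IsOpen {p | f p ≠ 0} :=
    isOpen_ne_fun hf continuous_const
  have hg (n : ℕ) {u : K → L} (hu : Continuous u) {U : Set L} (hU : IsOpen U) :
      IsOpen {p : ℝ × MilnorE K | ∃ x ∈ U, (p.2.g n).map u = some x} :=
    (continuous_iff.1 ((continuous_map hu).comp continuous_snd)).2 n U hU
  refine continuous_iff.2 ⟨fun n => ?_, fun n U hU => ?_⟩
  · change Continuous fun p : ℝ × MilnorE K =>
      (stay p.1 p.2 + (moved p.1 p.2).mapDomain (· + 1) : ℕ →₀ ℝ) n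
    simp only [Finsupp.add_apply]
    cases n with
    | zero =>
      have h (p : ℝ × MilnorE K) : ((moved p.1 p.2).mapDomain (· + 1) : ℕ →₀ ℝ) 0 = 0 :=
        Finsupp.mapDomain_of_notMem_range _ _ (by simp)
      simpa only [h, add_zero] using hs 0
    | succ n =>
      simp only [Finsupp.mapDomain_apply (add_left_injective 1)]
      exact (hs _).add (hm _)
  · change IsOpen {p : ℝ × MilnorE K | ∃ x ∈ U, shiftCoord v v' p.1 p.2 n = some x}
    cases n with
    | zero =>
      convert (hne (hs 0)).inter (hg 0 hv hU) using 1
      ext p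
      simp only [shiftCoord, Set.mem_inter_iff, Set.mem_ofPred_eq]
      split_ifs with h <;> simp [h]
    | succ n =>
      convert ((hne (hs (n + 1))).inter (hg (n + 1) hv hU)).union
        ((hne (hm n)).inter (hg n hv' hU)) using 1
      ext p
      simp only [shiftCoord, Set.mem_inter_iff, Set.mem_union, Set.mem_ofPred_eq]
      split_ifs with h h'
      · simp [h, h']
      · simp [h, h']
      · simp [h, moved_eq_zero h]

end Shift

end MilnorE

/-! ### Maps and homotopies of orbit spaces -/

section OrbitMaps

variable {K L Y Y' : Type*} [Group K] [Group L] [MulAction K Y] [MulAction L Y']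
  [TopologicalSpace Y] [TopologicalSpace Y']

/-- The map of orbit spaces induced by a continuous map that sends orbits into orbits. -/
def orbitMap (K L : Type*) [Group K] [Group L] [MulAction K Y] [MulAction L Y'] (f : Y → Y')
    (hf : Continuous f) (h : ∀ (k : K) (y : Y), ∃ l : L, f (k • y) = l • f y) :
    C(MulAction.orbitRel.Quotient K Y, MulAction.orbitRel.Quotient L Y') where
  toFun := Quotient.map f (by
    rintro _ y ⟨k, rfl⟩
    obtain ⟨l, hl⟩ := h k y
    exact ⟨l, hl.symm⟩)
  continuous_toFun := continuous_quot_lift _ (continuous_quotient_mk'.comp hf)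

theorem orbit_mk_eq {K Y : Type*} [Group K] [MulAction K Y] (k : K) (y : Y) :
    (Quotient.mk _ (k • y) : MulAction.orbitRel.Quotient K Y) = Quotient.mk _ y :=
  Quotient.sound ⟨k, rfl⟩

/-- A homotopy through maps that send orbits into orbits induces a homotopy of the maps of orbit
spaces. -/
theorem orbitMap_homotopic [ContinuousConstSMul K Y]
    {f₀ f₁ : C(MulAction.orbitRel.Quotient K Y, MulAction.orbitRel.Quotient L Y')}
    (H : ℝ × Y → Y') (hH : Continuous H)
    (h : ∀ (s : ℝ) (k : K) (y : Y), ∃ l : L, H (s, k • y) = l • H (s, y))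
    (h₀ : ∀ y, f₀ (Quotient.mk _ y) = Quotient.mk _ (H (0, y)))
    (h₁ : ∀ y, f₁ (Quotient.mk _ y) = Quotient.mk _ (H (1, y))) : f₀.Homotopic f₁ := by
  have hc (s : ℝ) : Continuous fun y => H (s, y) := by fun_prop
  refine ⟨{ toFun := fun p => orbitMap K L _ (hc p.1) (h p.1) p.2, continuous_toFun := ?_,
            map_zero_left := ?_, map_one_left := ?_ }⟩
  · have hq : IsOpenQuotientMap (Prod.map id (Quotient.mk (MulAction.orbitRel K Y)) :
        unitInterval × Y → unitInterval × MulAction.orbitRel.Quotient K Y) :=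
      IsOpenQuotientMap.id.prodMap MulAction.isOpenQuotientMap_quotientMk
    refine hq.isQuotientMap.continuous_iff.2 ?_
    change Continuous fun p : unitInterval × Y =>
      (Quotient.mk _ (H (p.1, p.2)) : MulAction.orbitRel.Quotient L Y')
    exact continuous_quotient_mk'.comp (by fun_prop)
  · rintro ⟨y⟩
    exact (h₀ y).symm
  · rintro ⟨y⟩
    exact (h₁ y).symm

end OrbitMaps

/-! ### Reduction from G² to G by means of a section -/

section GaugeReduction

variable {G Z M : Type*} [Group G]
  [TopologicalSpace Z] [MulAction (G × G) Z] [TopologicalSpace M] [MulAction G M]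
  {Φ : Z → M} {s : M → Z} {c : Z → G}

/-- The maps induced by Φ and s are mutually inverse: Φ ∘ s is the identity, and by `hz` the points
z and s(Φ z) lie in one orbit. -/
theorem exists_orbit_homeomorph (hΦ : Continuous Φ) (hs : Continuous s)
    (hΦs : ∀ x, Φ (s x) = x) (hΦg : ∀ (g : G × G) z, Φ (g • z) = g.1 • Φ z)
    (hsg : ∀ (g : G) x, s (g • x) = (g, g) • s x)
    (hz : ∀ z, z = ((1, (c z)⁻¹) : G × G) • s (Φ z)) :
    ∃ f : MulAction.orbitRel.Quotient (G × G) Z ≃ₜ MulAction.orbitRel.Quotient G M,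
      ∀ z : Z, f (Quotient.mk _ z) = Quotient.mk _ (Φ z) := by
  let F := orbitMap (G × G) G Φ hΦ fun g z => ⟨g.1, hΦg g z⟩
  let B := orbitMap G (G × G) s hs fun g x => ⟨(g, g), hsg g x⟩
  refine ⟨⟨⟨F, B, ?_, ?_⟩, F.continuous, B.continuous⟩, fun z => rfl⟩
  · rintro ⟨z⟩
    change Quotient.mk _ (s (Φ z)) = Quotient.mk _ z
    conv_rhs => rw [hz z]
    exact (orbit_mk_eq _ _).symm
  · rintro ⟨x⟩
    change Quotient.mk _ (Φ (s x)) = Quotient.mk _ x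
    rw [hΦs]

/-- The homotopies from which a homotopy between the identity of `Z_{hG²}` and the map induced by
`s ∘ Φ` is put together. -/
def reductionHomotopy (Φ : Z → M) (s : M → Z) (c : Z → G) (v : G × G → G × G)
    (p : ℝ × MilnorE (G × G) × Z) : MilnorE (G × G) × Z :=
  (MilnorE.shift v id p.1 (((1, c p.2.2) : G × G) • p.2.1), s (Φ p.2.2))

omit [MulAction (G × G) Z] [MulAction G M] in
theorem continuous_reductionHomotopy [TopologicalSpace G] [IsTopologicalGroup G]
    (hΦ : Continuous Φ) (hs : Continuous s) (hc : Continuous c) {v : G × G → G × G}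
    (hv : Continuous v) : Continuous (reductionHomotopy Φ s c v) := by
  have h1 : Continuous fun p : ℝ × MilnorE (G × G) × Z => ((1, c p.2.2) : G × G) :=
    continuous_const.prodMk (hc.comp (continuous_snd.comp continuous_snd))
  have h2 : Continuous fun p : ℝ × MilnorE (G × G) × Z => ((1, c p.2.2) : G × G) • p.2.1 :=
    h1.smul (continuous_fst.comp continuous_snd)
  exact ((MilnorE.continuous_shift hv continuous_id).comp (continuous_fst.prodMk h2)).prodMk
    (hs.comp (hΦ.comp (continuous_snd.comp continuous_snd)))

omit [TopologicalSpace Z] [TopologicalSpace M] in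
-- The equivariance of c gives (1, c(g·z))(g₁, g₂) = (g₁, g₁)(1, c(z)). The component g₂ thus
-- disappears, and v needs to respect only the diagonal, which both v = id and v = δ ∘ pr₁ do.
theorem reductionHomotopy_smul (hΦg : ∀ (g : G × G) z, Φ (g • z) = g.1 • Φ z)
    (hsg : ∀ (g : G) x, s (g • x) = (g, g) • s x)
    (hcg : ∀ (g : G × G) z, c (g • z) = g.1 * c z * g.2⁻¹) {v : G × G → G × G}
    (hv : ∀ (g : G) x, v ((g, g) * x) = (g, g) * v x) (t : ℝ) (g : G × G)
    (p : MilnorE (G × G) × Z) :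
    reductionHomotopy Φ s c v (t, g • p) =
      ((g.1, g.1) : G × G) • reductionHomotopy Φ s c v (t, p) := by
  refine Prod.ext ?_ ?_
  · change MilnorE.shift v id t (((1, c (g • p.2)) : G × G) • g • p.1) =
      ((g.1, g.1) : G × G) • MilnorE.shift v id t (((1, c p.2) : G × G) • p.1)
    rw [← MilnorE.shift_smul (v' := id) (hv g.1) (fun x => rfl), smul_smul, smul_smul, hcg]
    congr 2
    ext <;> simp
  · change s (Φ (g • p.2)) = ((g.1, g.1) : G × G) • s (Φ p.2)
    rw [hΦg, hsg]

/-- The inverse is induced by s and the diagonal δ. Both its composite with the given map and the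
identity of the homotopy orbit space of Z are time-0 maps of `reductionHomotopy`, for v = δ ∘ pr₁
and v = id. By `MilnorE.shift_one` the two homotopies end in the same map `mid`. -/
theorem exists_homotopyEquiv [TopologicalSpace G] [IsTopologicalGroup G]
    [ContinuousConstSMul (G × G) Z] [ContinuousConstSMul G M]
    (hΦ : Continuous Φ) (hs : Continuous s) (hc : Continuous c)
    (hΦs : ∀ x, Φ (s x) = x) (hΦg : ∀ (g : G × G) z, Φ (g • z) = g.1 • Φ z)
    (hsg : ∀ (g : G) x, s (g • x) = (g, g) • s x)
    (hcg : ∀ (g : G × G) z, c (g • z) = g.1 * c z * g.2⁻¹)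
    (hz : ∀ z, z = ((1, (c z)⁻¹) : G × G) • s (Φ z)) :
    ∃ e : ContinuousMap.HomotopyEquiv (HomotopyOrbit (G × G) Z) (HomotopyOrbit G M),
      ∀ (a : MilnorE (G × G)) (z : Z),
        e (HomotopyOrbit.mk a z) = HomotopyOrbit.mk (a.map Prod.fst) (Φ z) := by
  let δ : G → G × G := fun g => (g, g)
  have hδ : Continuous δ := by fun_prop
  let F : C(HomotopyOrbit (G × G) Z, HomotopyOrbit G M) :=
    orbitMap (G × G) G (fun p => (p.1.map Prod.fst, Φ p.2))
      (((MilnorE.continuous_map continuous_fst).comp continuous_fst).prodMk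
        (hΦ.comp continuous_snd))
      fun g p => ⟨g.1, Prod.ext (MilnorE.map_smul _ g g.1 (fun _ => rfl) _) (hΦg g p.2)⟩
  let B : C(HomotopyOrbit G M, HomotopyOrbit (G × G) Z) :=
    orbitMap G (G × G) (fun p => (p.1.map δ, s p.2))
      (((MilnorE.continuous_map hδ).comp continuous_fst).prodMk (hs.comp continuous_snd))
      fun g p => ⟨(g, g), Prod.ext (MilnorE.map_smul _ g (g, g) (fun _ => rfl) _) (hsg g p.2)⟩
  have hFB : F.comp B = ContinuousMap.id _ := by
    ext q
    obtain ⟨e, x⟩ := q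
    change Quotient.mk _ ((e.map δ).map Prod.fst, Φ (s x)) = Quotient.mk _ (e, x)
    rw [hΦs, MilnorE.map_map]
    exact congrArg (fun e' => Quotient.mk _ (e', x)) (MilnorE.map_id e)
  have hH (v : G × G → G × G) (hv : Continuous v) : Continuous (reductionHomotopy Φ s c v) :=
    continuous_reductionHomotopy hΦ hs hc hv
  have hHg (v : G × G → G × G) (hv : ∀ (g : G) x, v ((g, g) * x) = (g, g) * v x) (t : ℝ)
      (g : G × G) (p : MilnorE (G × G) × Z) :
      ∃ g' : G × G, reductionHomotopy Φ s c v (t, g • p) = g' • reductionHomotopy Φ s c v (t, p) :=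
    ⟨(g.1, g.1), reductionHomotopy_smul hΦg hsg hcg hv t g p⟩
  have hBF : (B.comp F).Homotopic (ContinuousMap.id _) := by
    let mid : C(HomotopyOrbit (G × G) Z, HomotopyOrbit (G × G) Z) :=
      orbitMap (G × G) (G × G) (fun p => reductionHomotopy Φ s c id (1, p))
        ((hH id continuous_id).comp (Continuous.prodMk_right 1)) (hHg id (fun _ _ => rfl) 1)
    have h1 : (B.comp F).Homotopic mid := by
      refine orbitMap_homotopic (reductionHomotopy Φ s c (δ ∘ Prod.fst))
        (hH _ (hδ.comp continuous_fst))
        (hHg _ fun _ _ => rfl) ?_ ?_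
      · rintro ⟨e, z⟩
        change Quotient.mk _ ((e.map Prod.fst).map δ, s (Φ z)) =
          Quotient.mk _ (MilnorE.shift _ _ _ _, s (Φ z))
        -- The first projection does not see the factor (1, c z), so translating by it changes
        -- nothing here.
        rw [MilnorE.shift_zero, MilnorE.map_map,
          MilnorE.map_smul (δ ∘ Prod.fst) (1, c z) 1 (fun x => by simp [δ]), one_smul]
      · rintro ⟨e, z⟩
        change Quotient.mk _ (MilnorE.shift _ _ _ _, s (Φ z)) =
          Quotient.mk _ (MilnorE.shift _ _ _ _, s (Φ z))
        rw [MilnorE.shift_one]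
    have h2 : (ContinuousMap.id (HomotopyOrbit (G × G) Z)).Homotopic mid := by
      refine orbitMap_homotopic (reductionHomotopy Φ s c id) (hH _ continuous_id)
        (hHg _ fun _ _ => rfl) ?_ ?_
      · rintro ⟨e, z⟩
        change Quotient.mk _ (e, z) = Quotient.mk _ (MilnorE.shift _ _ _ _, s (Φ z))
        rw [MilnorE.shift_zero, MilnorE.map_id]
        -- Writing z as the translate of s(Φ z) by (1, c⁻¹) and then moving the whole pair by (1, c)
        -- puts the representative in the form of the homotopy at time 0.
        conv_lhs => rw [hz z]
        rw [← orbit_mk_eq ((1, c z) : G × G)]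
        congr 1
        refine Prod.ext rfl ?_
        change ((1, c z) : G × G) • ((1, (c z)⁻¹) : G × G) • s (Φ z) = s (Φ z)
        rw [smul_smul, Prod.mk_mul_mk, mul_one, mul_inv_cancel]
        exact one_smul _ _
      · rintro ⟨e, z⟩
        rfl
    exact h1.trans h2.symm
  exact ⟨⟨F, B, hBF, by rw [hFB]⟩, fun a z => rfl⟩

end GaugeReduction

/-! ### Left-invariant fields and one-parameter subgroups in the chart at 1 -/

section ExpLocal

open Topology

variable {E : Type*} [NormedAddCommGroup E] [NormedSpace ℝ E]
  {G : Type*} [TopologicalSpace G] [Group G] [ChartedSpace E G] [LieGroup 𝓘(ℝ, E) ∞ G]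

variable (E G) in
/-- The chart of `G` at the identity. -/
abbrev chartOne : PartialEquiv G E := extChartAt 𝓘(ℝ, E) (1 : G)

variable (E G) in
/-- The multiplication of `G` in the chart at the identity. -/
def chartMul (p : E × E) : E :=
  chartOne E G ((chartOne E G).symm p.1 * (chartOne E G).symm p.2)

omit [LieGroup 𝓘(ℝ, E) ∞ G] in
theorem chartOne_symm_one : (chartOne E G).symm (chartOne E G 1) = 1 :=
  extChartAt_to_inv _

/-- Class C² suffices: its partial derivative `chartField` is then C¹, hence Lipschitz near the base
point, as the Gronwall argument requires. -/
theorem contDiffAt_chartMul :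
    ContDiffAt ℝ 2 (chartMul E G) (chartOne E G 1, chartOne E G 1) := by
  have hM : IsManifold 𝓘(ℝ, E) 2 G := IsManifold.of_le (n := ∞) ENat.LEInfty.out
  have hG : LieGroup 𝓘(ℝ, E) 2 G := LieGroup.of_le (n := ∞) ENat.LEInfty.out
  have hsymm : ContMDiffAt 𝓘(ℝ, E) 𝓘(ℝ, E) 2 (chartOne E G).symm (chartOne E G 1) :=
    (contMDiffOn_extChartAt_symm (1 : G)).contMDiffAt
      (extChartAt_target_mem_nhds (I := 𝓘(ℝ, E)) (1 : G))
  have h1 : ContMDiffAt 𝓘(ℝ, E × E) 𝓘(ℝ, E) 2 (fun p : E × E => (chartOne E G).symm p.1)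
      (chartOne E G 1, chartOne E G 1) :=
    ContMDiffAt.comp (I' := 𝓘(ℝ, E)) (chartOne E G 1, chartOne E G 1) hsymm
      contDiff_fst.contMDiff.contMDiffAt
  have h2 : ContMDiffAt 𝓘(ℝ, E × E) 𝓘(ℝ, E) 2 (fun p : E × E => (chartOne E G).symm p.2)
      (chartOne E G 1, chartOne E G 1) :=
    ContMDiffAt.comp (I' := 𝓘(ℝ, E)) (chartOne E G 1, chartOne E G 1) hsymm
      contDiff_snd.contMDiff.contMDiffAt
  have h3 := h1.mul h2
  have h4 : ContMDiffAt 𝓘(ℝ, E) 𝓘(ℝ, E) 2 (chartOne E G)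
      ((chartOne E G).symm (chartOne E G 1) * (chartOne E G).symm (chartOne E G 1)) := by
    rw [chartOne_symm_one, mul_one]
    exact contMDiffAt_extChartAt
  exact contMDiffAt_iff_contDiffAt.1
    (ContMDiffAt.comp (I' := 𝓘(ℝ, E)) (chartOne E G 1, chartOne E G 1) h4 h3)

variable (E G) in
/-- The derivative of `chartMul` in the second variable: `chartField y X` is the value at `y` of the
left-invariant vector field of `X`, in the chart at the identity. -/
def chartField (y : E) : E →L[ℝ] E :=
  (fderiv ℝ (chartMul E G) (y, chartOne E G 1)).comp (ContinuousLinearMap.inr ℝ E E)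

theorem contDiffAt_chartField : ContDiffAt ℝ 1 (chartField E G) (chartOne E G 1) := by
  have h1 : ContDiffAt ℝ 1 (fderiv ℝ (chartMul E G)) (chartOne E G 1, chartOne E G 1) :=
    contDiffAt_chartMul.fderiv_right (by norm_num)
  have h2 : ContDiffAt ℝ 1 (fun y : E => fderiv ℝ (chartMul E G) (y, chartOne E G 1))
      (chartOne E G 1) :=
    ContDiffAt.comp (f := fun y : E => (y, chartOne E G 1)) (chartOne E G 1) h1
      (contDiff_id.prodMk contDiff_const).contDiffAt
  exact h2.clm_comp contDiffAt_const

theorem chartField_one : chartField E G (chartOne E G 1) = ContinuousLinearMap.id ℝ E := by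
  have h1 : HasFDerivAt (fun z : E => chartMul E G (chartOne E G 1, z))
      (chartField E G (chartOne E G 1)) (chartOne E G 1) :=
    ((contDiffAt_chartMul (E := E) (G := G)).differentiableAt (by norm_num)).hasFDerivAt.comp
      (chartOne E G 1) (hasFDerivAt_prodMk_right (𝕜 := ℝ) (chartOne E G 1) (chartOne E G 1))
  have h2 : HasFDerivAt (fun z : E => chartMul E G (chartOne E G 1, z))
      (ContinuousLinearMap.id ℝ E) (chartOne E G 1) := by
    refine (hasFDerivAt_id (chartOne E G 1)).congr_of_eventuallyEq ?_
    filter_upwards [extChartAt_target_mem_nhds (I := 𝓘(ℝ, E)) (1 : G)] with z hz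
    rw [chartMul, chartOne_symm_one, one_mul, (chartOne E G).right_inv hz, id]
  exact h1.unique h2

variable [CompleteSpace E] [T2Space G]

variable (G) in
/-- The one-parameter subgroups of `G`, parametrized by the model space of `G`. -/
def flow (X : E) (t : ℝ) : G := oneParam (show LieAlg E G from X) t

theorem flow_zero (X : E) : flow G X 0 = 1 := oneParam_zero (E := E) (G := G) X

theorem flow_add (X : E) (s t : ℝ) : flow G X (s + t) = flow G X s * flow G X t :=
  oneParam_add (E := E) (G := G) X s t

theorem flow_smul (X : E) (r t : ℝ) : flow G (r • X) t = flow G X (t * r) := by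
  have h1 : lieExp (E := E) (G := G) ((t * r) • X) = flow G X (t * r) := lieExp_smul (E := E) X _
  have h2 : lieExp (E := E) (G := G) (t • r • X) = flow G (r • X) t :=
    lieExp_smul (E := E) (r • X) _
  rw [← h1, ← h2, smul_smul]

theorem continuous_flow (X : E) : Continuous (flow G X) :=
  continuous_iff_continuousAt.2 fun t => (oneParam_curve (E := E) (G := G) X t).continuousAt

theorem hasDerivAt_chart_flow_zero (X : E) :
    HasDerivAt (fun t => chartOne E G (flow G X t)) X 0 := by
  have hM : IsManifold 𝓘(ℝ, E) 1 G := IsManifold.of_le (n := ∞) (by simp)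
  have h1 := oneParam_curve (E := E) (G := G) X 0
  have h2 : MDifferentiableAt 𝓘(ℝ, E) 𝓘(ℝ, E) (chartOne E G) (flow G X 0) := by
    rw [flow_zero]
    exact contMDiffAt_extChartAt.mdifferentiableAt one_ne_zero
  -- A variable base point is used because `flow G X 0` equals 1 only propositionally, while the
  -- tangent spaces depend on it.
  have key : ∀ g : G, g = 1 → (mfderiv 𝓘(ℝ, E) 𝓘(ℝ, E) (chartOne E G) g : E →L[ℝ] E)
      (mulInvariantVectorField (I := 𝓘(ℝ, E)) (G := G) X g : E) = X := by
    rintro g rfl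
    have e1 : (mfderiv 𝓘(ℝ, E) 𝓘(ℝ, E) (chartOne E G) 1 : E →L[ℝ] E)
        = ContinuousLinearMap.id ℝ E := mfderiv_extChartAt_self
    have e2 : (mulInvariantVectorField (I := 𝓘(ℝ, E)) (G := G) X 1 : E) = X := by
      have : (fun x : G => (1 : G) * x) = id := by funext x; simp
      unfold mulInvariantVectorField
      rw [this]
      exact congrArg (fun L : E →L[ℝ] E => L X) (mfderiv_id (I := 𝓘(ℝ, E)) (x := (1 : G)))
    exact (congrArg (fun L : E →L[ℝ] E => L _) e1).trans e2
  obtain ⟨L, hL, hL1⟩ : ∃ L : ℝ →L[ℝ] E,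
      HasFDerivAt (fun t => chartOne E G (flow G X t)) L (0 : ℝ) ∧ L 1 = X := by
    refine ⟨_, (h2.hasMFDerivAt.comp 0 h1).hasFDerivAt, ?_⟩
    refine Eq.trans ?_ (key _ (flow_zero X))
    exact congrArg (mfderiv 𝓘(ℝ, E) 𝓘(ℝ, E) (chartOne E G) (flow G X 0) : E →L[ℝ] E)
      (one_smul ℝ (mulInvariantVectorField (I := 𝓘(ℝ, E)) (G := G) X (flow G X 0) : E))
  exact hL.hasDerivAt.congr_deriv hL1

/-- By the addition law the curve near time t is the product of its value at t with its values near
time 0. So the derivative at 0 and the chain rule for `chartMul` give the differential equation in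
the chart. -/
theorem hasDerivAt_chart_flow {X : E} {t : ℝ} (hs : flow G X t ∈ (chartOne E G).source)
    (hd : DifferentiableAt ℝ (chartMul E G) (chartOne E G (flow G X t), chartOne E G 1)) :
    HasDerivAt (fun t => chartOne E G (flow G X t))
      (chartField E G (chartOne E G (flow G X t)) X) t := by
  set x := fun t => chartOne E G (flow G X t) with hx
  have h0 : x 0 = chartOne E G 1 := by simp only [hx, flow_zero]
  have h1 : HasDerivAt (fun s => chartMul E G (x t, x s)) (chartField E G (x t) X) 0 := by
    have hd' : HasFDerivAt (chartMul E G) (fderiv ℝ (chartMul E G) (x t, chartOne E G 1))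
        (x t, x 0) := by rw [h0]; exact hd.hasFDerivAt
    exact hd'.comp_hasDerivAt 0
      ((hasDerivAt_const 0 (x t)).prodMk (hasDerivAt_chart_flow_zero (G := G) X))
  have h2 : (fun s => chartMul E G (x t, x s)) =ᶠ[𝓝 0] fun s => x (t + s) := by
    have hn : (chartOne E G).source ∈ 𝓝 (flow G X 0) := by
      rw [flow_zero]
      exact extChartAt_source_mem_nhds (I := 𝓘(ℝ, E)) (1 : G)
    filter_upwards [(continuous_flow (G := G) X).continuousAt.preimage_mem_nhds hn] with s hs'
    change chartOne E G ((chartOne E G).symm (chartOne E G (flow G X t)) *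
      (chartOne E G).symm (chartOne E G (flow G X s))) = chartOne E G (flow G X (t + s))
    rw [(chartOne E G).left_inv hs, (chartOne E G).left_inv hs', flow_add]
  have h3 : HasDerivAt (fun s => x (t + s)) (chartField E G (x t) X) (t - t) := by
    rw [sub_self]
    exact h1.congr_of_eventuallyEq h2.symm
  have h4 := h3.comp_sub_const t t
  simp only [add_sub_cancel] at h4
  exact h4

end ExpLocal

/-! ### Strict differentiability of the exponential map at 0 -/

section ExpEstimates

open Topology

variable {E : Type*} [NormedAddCommGroup E] [NormedSpace ℝ E] [FiniteDimensional ℝ E]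
  [CompleteSpace E]
  {G : Type*} [TopologicalSpace G] [T2Space G] [Group G] [ChartedSpace E G]
  [LieGroup 𝓘(ℝ, E) ∞ G]

variable (E G) in
/-- A ball in the chart at the identity, on which the left-invariant vector fields satisfy a
Lipschitz condition. -/
structure IsGoodBall (r K : ℝ) : Prop where
  r_pos : 0 < r
  K_pos : 0 < K
  mul_le : K * r ≤ 1
  subset : Metric.closedBall (chartOne E G 1) r ⊆ (chartOne E G).target
  diff : ∀ y ∈ Metric.closedBall (chartOne E G 1) r,
    DifferentiableAt ℝ (chartMul E G) (y, chartOne E G 1)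
  lip : ∀ y ∈ Metric.closedBall (chartOne E G 1) r,
    ∀ y' ∈ Metric.closedBall (chartOne E G 1) r,
      ‖chartField E G y - chartField E G y'‖ ≤ K * ‖y - y'‖

omit [FiniteDimensional ℝ E] [CompleteSpace E] [T2Space G] in
variable (E G) in
theorem exists_isGoodBall : ∃ r K, IsGoodBall E G r K := by
  obtain ⟨K, t, ht, hK⟩ :=
    (contDiffAt_chartField (E := E) (G := G)).exists_lipschitzOnWith
  have hd : ∀ᶠ y in 𝓝 (chartOne E G 1),
      DifferentiableAt ℝ (chartMul E G) (y, chartOne E G 1) := by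
    have h1 : ∀ᶠ p in 𝓝 (chartOne E G 1, chartOne E G 1),
        ContDiffAt ℝ 2 (chartMul E G) p :=
      (contDiffAt_chartMul (E := E) (G := G)).eventually (by simp)
    have h2 : Filter.Tendsto (fun y : E => (y, chartOne E G 1)) (𝓝 (chartOne E G 1))
        (𝓝 (chartOne E G 1, chartOne E G 1)) :=
      (Continuous.prodMk_left (chartOne E G 1)).tendsto _
    exact (h2.eventually h1).mono fun y hy => hy.differentiableAt (by norm_num)
  obtain ⟨ε, hε, hball⟩ := Metric.mem_nhds_iff.1
    (Filter.inter_mem (Filter.inter_mem ht (extChartAt_target_mem_nhds (I := 𝓘(ℝ, E)) (1 : G))) hd)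
  have hK1 : (0 : ℝ) < K + 1 := by positivity
  -- The radius ε/2 puts the closed ball inside the open one, and 1/(K + 1) makes constant times
  -- radius at most 1. Adding 1 to K makes the constant positive.
  refine ⟨min (ε / 2) (1 / (K + 1)), K + 1, by positivity, hK1, ?_, ?_, ?_, ?_⟩
  · calc ((K : ℝ) + 1) * min (ε / 2) (1 / (K + 1)) ≤ (K + 1) * (1 / (K + 1)) := by
          gcongr; exact min_le_right _ _
      _ = 1 := by field_simp
  all_goals
    have hsub : Metric.closedBall (chartOne E G 1) (min (ε / 2) (1 / ((K : ℝ) + 1))) ⊆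
        Metric.ball (chartOne E G 1) ε := fun y hy =>
      lt_of_le_of_lt (hy.trans (min_le_left _ _)) (half_lt_self hε)
  · exact fun y hy => (hball (hsub hy)).1.2
  · exact fun y hy => (hball (hsub hy)).2
  · intro y hy y' hy'
    have h := hK.dist_le_mul _ (hball (hsub hy)).1.1 _ (hball (hsub hy')).1.1
    rw [dist_eq_norm, dist_eq_norm] at h
    refine h.trans ?_
    gcongr
    simp

variable {r K : ℝ}

namespace IsGoodBall

omit [FiniteDimensional ℝ E] [CompleteSpace E] [T2Space G] in
theorem norm_chartField_sub_id_le (h : IsGoodBall E G r K) {y : E}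
    (hy : y ∈ Metric.closedBall (chartOne E G 1) r) :
    ‖chartField E G y - ContinuousLinearMap.id ℝ E‖ ≤ K * ‖y - chartOne E G 1‖ := by
  rw [← chartField_one (E := E) (G := G)]
  exact h.lip y hy _ (Metric.mem_closedBall_self h.r_pos.le)

omit [FiniteDimensional ℝ E] [CompleteSpace E] [T2Space G] in
theorem norm_chartField_apply_le (h : IsGoodBall E G r K) {y : E}
    (hy : y ∈ Metric.closedBall (chartOne E G 1) r) (X : E) :
    ‖chartField E G y X‖ ≤ 2 * ‖X‖ := by
  have h1 : ‖chartField E G y - ContinuousLinearMap.id ℝ E‖ ≤ 1 := by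
    refine (h.norm_chartField_sub_id_le hy).trans (le_trans ?_ h.mul_le)
    have := h.K_pos.le
    gcongr
    rwa [← dist_eq_norm]
  have h2 := (chartField E G y - ContinuousLinearMap.id ℝ E).le_of_opNorm_le h1 X
  have h3 : chartField E G y X = (chartField E G y - ContinuousLinearMap.id ℝ E) X + X := by simp
  rw [h3]
  refine (norm_add_le _ _).trans ?_
  linarith

omit [FiniteDimensional ℝ E] in
theorem hasDerivAt (h : IsGoodBall E G r K) {X : E} {t : ℝ}
    (hs : flow G X t ∈ (chartOne E G).source)
    (hy : chartOne E G (flow G X t) ∈ Metric.closedBall (chartOne E G 1) r) :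
    HasDerivAt (fun t => chartOne E G (flow G X t))
      (chartField E G (chartOne E G (flow G X t)) X) t :=
  hasDerivAt_chart_flow hs (h.diff _ hy)

/-- The one-parameter subgroups of small vectors stay in the chart up to time `1`. -/
theorem flow_mem (h : IsGoodBall E G r K) {X : E} (hX : 4 * ‖X‖ ≤ r) {t : ℝ}
    (ht : t ∈ Set.Icc (0 : ℝ) 1) :
    flow G X t ∈ (chartOne E G).source ∧
      ‖chartOne E G (flow G X t) - chartOne E G 1‖ ≤ 2 * ‖X‖ * t := by
  set S := {t : ℝ | flow G X t ∈ (chartOne E G).source ∧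
      ‖chartOne E G (flow G X t) - chartOne E G 1‖ ≤ 2 * ‖X‖ * t} with hS
  have hr := h.r_pos
  have hball : ∀ t ∈ S, t ≤ 1 →
      chartOne E G (flow G X t) ∈ Metric.ball (chartOne E G 1) r := by
    intro t ht h1
    rw [mem_ball_iff_norm]
    refine ht.2.trans_lt ?_
    have := norm_nonneg X
    nlinarith
  have hsrc : IsOpen (chartOne E G).source := isOpen_extChartAt_source (I := 𝓘(ℝ, E)) (1 : G)
  have hcont : ContinuousOn (chartOne E G) (chartOne E G).source :=
    continuousOn_extChartAt (I := 𝓘(ℝ, E)) (1 : G)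
  -- Continuous induction on [0, 1]: the good times form a closed set, contain 0, and can always be
  -- prolonged beyond a good time less than 1.
  refine IsClosed.Icc_subset_of_forall_exists_gt (s := S) (a := 0) (b := 1) ?_ ?_ ?_ ht
  -- In finite dimension the closed ball is compact, so its image is closed in the Hausdorff space
  -- G. This keeps limits of good times inside the domain of the chart.
  · set N := (chartOne E G).symm '' Metric.closedBall (chartOne E G 1) r with hN
    have hNc : IsClosed N := (((isCompact_closedBall _ _).image_of_continuousOn
      ((continuousOn_extChartAt_symm (I := 𝓘(ℝ, E)) (1 : G)).mono h.subset))).isClosed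
    have hNs : N ⊆ (chartOne E G).source := by
      rintro _ ⟨y, hy, rfl⟩
      exact (chartOne E G).map_target (h.subset hy)
    have hSN : S ∩ Set.Icc 0 1 = {t ∈ Set.Icc 0 1 ∩ flow G X ⁻¹' N |
        ‖chartOne E G (flow G X t) - chartOne E G 1‖ ≤ 2 * ‖X‖ * t} := by
      ext t
      constructor
      · rintro ⟨h1, h2⟩
        exact ⟨⟨h2, _, Metric.ball_subset_closedBall (hball t h1 h2.2),
          (chartOne E G).left_inv h1.1⟩, h1.2⟩
      · rintro ⟨⟨h1, h2⟩, h3⟩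
        exact ⟨⟨hNs h2, h3⟩, h1⟩
    rw [hSN]
    refine (isClosed_Icc.inter (hNc.preimage (continuous_flow X))).isClosed_le ?_ (by fun_prop)
    refine ((hcont.comp (continuous_flow X).continuousOn ?_).sub continuousOn_const).norm
    exact fun t ht => hNs ht.2
  · refine ⟨?_, ?_⟩
    · rw [flow_zero]
      exact mem_extChartAt_source (I := 𝓘(ℝ, E)) (1 : G)
    · rw [flow_zero]
      simp
  -- At a good time the curve is strictly inside the ball, as 2‖X‖t ≤ r/2. It stays there for a
  -- while, and the speed bound 2‖X‖ with the mean value inequality extends the estimate.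
  · rintro t ⟨htS, ht0, ht1⟩ y hy
    have hO : IsOpen (flow G X ⁻¹' ((chartOne E G).source ∩
        chartOne E G ⁻¹' Metric.ball (chartOne E G 1) r)) :=
      (hcont.isOpen_inter_preimage hsrc Metric.isOpen_ball).preimage (continuous_flow X)
    obtain ⟨ε, hε, hεO⟩ := Metric.isOpen_iff.1 hO t ⟨htS.1, hball t htS ht1.le⟩
    set u := min y (t + ε / 2) with hu
    have htu : t < u := lt_min hy (by linarith)
    have hxu : ∀ x ∈ Set.Icc t u, flow G X x ∈ (chartOne E G).source ∧
        chartOne E G (flow G X x) ∈ Metric.ball (chartOne E G 1) r := by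
      intro x hx
      refine hεO ?_
      rw [Metric.mem_ball, Real.dist_eq, abs_of_nonneg (by linarith [hx.1])]
      linarith [hx.2, min_le_right y (t + ε / 2)]
    refine ⟨u, ⟨(hxu u ⟨htu.le, le_rfl⟩).1, ?_⟩, htu, min_le_left _ _⟩
    have hmv := Convex.norm_image_sub_le_of_norm_hasDerivWithin_le
      (f := fun t => chartOne E G (flow G X t)) (s := Set.Icc t u) (C := 2 * ‖X‖)
      (fun x hx => (h.hasDerivAt (hxu x hx).1
        (Metric.ball_subset_closedBall (hxu x hx).2)).hasDerivWithinAt)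
      (fun x hx => h.norm_chartField_apply_le (Metric.ball_subset_closedBall (hxu x hx).2) X)
      (convex_Icc t u) (Set.left_mem_Icc.2 htu.le) (Set.right_mem_Icc.2 htu.le)
    rw [Real.norm_eq_abs, abs_of_pos (sub_pos.2 htu)] at hmv
    calc ‖chartOne E G (flow G X u) - chartOne E G 1‖
        ≤ ‖chartOne E G (flow G X u) - chartOne E G (flow G X t)‖
          + ‖chartOne E G (flow G X t) - chartOne E G 1‖ := norm_sub_le_norm_sub_add_norm_sub _ _ _
      _ ≤ 2 * ‖X‖ * (u - t) + 2 * ‖X‖ * t := add_le_add hmv htS.2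
      _ = 2 * ‖X‖ * u := by ring

theorem flow_mem_closedBall (h : IsGoodBall E G r K) {X : E} (hX : 4 * ‖X‖ ≤ r) {t : ℝ}
    (ht : t ∈ Set.Icc (0 : ℝ) 1) :
    chartOne E G (flow G X t) ∈ Metric.closedBall (chartOne E G 1) r := by
  rw [mem_closedBall_iff_norm]
  refine (h.flow_mem hX ht).2.trans ?_
  have := norm_nonneg X
  have := h.r_pos
  nlinarith [ht.1, ht.2]

/-- The chart at the identity composed with `exp` is close to a translation near `0`. -/
theorem norm_flow_sub_le (h : IsGoodBall E G r K) {ρ : ℝ} (hρ : 0 < ρ) (hρr : 4 * ρ ≤ r)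
    {X Y : E} (hX : ‖X‖ ≤ ρ) (hY : ‖Y‖ ≤ ρ) :
    ‖chartOne E G (flow G X 1) - chartOne E G (flow G Y 1) - (X - Y)‖ ≤
      3 * (Real.exp (K * ρ) - 1) * ‖X - Y‖ := by
  have hK := h.K_pos
  have hX4 : 4 * ‖X‖ ≤ r := by linarith
  have hY4 : 4 * ‖Y‖ ≤ r := by linarith
  set x := fun t => chartOne E G (flow G X t) with hx
  set y := fun t => chartOne E G (flow G Y t) with hy
  -- The deviation from the linear motion t(X - Y); the aim is a differential inequality for its
  -- norm.
  set v : ℝ → E := fun t => x t - y t - t • (X - Y) with hv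
  have hdx (t : ℝ) (ht : t ∈ Set.Icc (0 : ℝ) 1) : HasDerivAt x (chartField E G (x t) X) t :=
    h.hasDerivAt (h.flow_mem hX4 ht).1 (h.flow_mem_closedBall hX4 ht)
  have hdy (t : ℝ) (ht : t ∈ Set.Icc (0 : ℝ) 1) : HasDerivAt y (chartField E G (y t) Y) t :=
    h.hasDerivAt (h.flow_mem hY4 ht).1 (h.flow_mem_closedBall hY4 ht)
  have hdv (t : ℝ) (ht : t ∈ Set.Icc (0 : ℝ) 1) : HasDerivAt v
      (chartField E G (x t) X - chartField E G (y t) Y - (X - Y)) t := by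
    exact (((hdx t ht).sub (hdy t ht)).sub ((hasDerivAt_id t).smul_const (X - Y))).congr_deriv
      (by rw [one_smul])
  have hbound (t : ℝ) (ht : t ∈ Set.Icc (0 : ℝ) 1) :
      ‖chartField E G (x t) X - chartField E G (y t) Y - (X - Y)‖ ≤
        K * ρ * ‖v t‖ + 3 * (K * ρ) * ‖X - Y‖ := by
    -- The first term costs 2Kρ‖X - Y‖, since x stays within 2ρ of the base point. The second costs
    -- Kρ(‖v‖ + ‖X - Y‖), since x - y = v + t(X - Y). Together they give the constant 3.
    have e : chartField E G (x t) X - chartField E G (y t) Y - (X - Y) =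
        (chartField E G (x t) - ContinuousLinearMap.id ℝ E) (X - Y) +
          (chartField E G (x t) - chartField E G (y t)) Y := by
      simp only [sub_apply, ContinuousLinearMap.id_apply, map_sub]
      abel
    have h1 : ‖chartField E G (x t) - ContinuousLinearMap.id ℝ E‖ ≤ K * (2 * ρ) := by
      refine (h.norm_chartField_sub_id_le (h.flow_mem_closedBall hX4 ht)).trans ?_
      gcongr
      refine (h.flow_mem hX4 ht).2.trans ?_
      have := norm_nonneg X
      nlinarith [ht.1, ht.2]
    have h2 : ‖chartField E G (x t) - chartField E G (y t)‖ ≤ K * (‖v t‖ + ‖X - Y‖) := by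
      refine (h.lip _ (h.flow_mem_closedBall hX4 ht) _ (h.flow_mem_closedBall hY4 ht)).trans ?_
      gcongr
      have e' : x t - y t = v t + t • (X - Y) := by simp [hv]
      rw [e']
      refine (norm_add_le _ _).trans ?_
      gcongr
      rw [norm_smul, Real.norm_eq_abs, abs_of_nonneg ht.1]
      exact mul_le_of_le_one_left (norm_nonneg _) ht.2
    rw [e]
    calc _ ≤ K * (2 * ρ) * ‖X - Y‖ + K * (‖v t‖ + ‖X - Y‖) * ρ := by
          refine (norm_add_le _ _).trans (add_le_add ?_ ?_)
          · exact ContinuousLinearMap.le_of_opNorm_le _ h1 _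
          · refine (ContinuousLinearMap.le_of_opNorm_le _ h2 _).trans ?_
            gcongr
      _ = _ := by ring
  have hv0 : ‖v 0‖ ≤ 0 := by
    simp [hv, hx, hy, flow_zero]
  have hgr := norm_le_gronwallBound_of_norm_deriv_right_le (a := 0) (b := 1)
    (fun t ht => (hdv t ht).continuousAt.continuousWithinAt)
    (fun t ht => (hdv t (Set.Ico_subset_Icc_self ht)).hasDerivWithinAt) hv0
    (fun t ht => hbound t (Set.Ico_subset_Icc_self ht)) 1 (by simp)
  have hKρ : K * ρ ≠ 0 := by positivity
  rw [gronwallBound_of_K_ne_0 hKρ] at hgr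
  have e1 : v 1 = x 1 - y 1 - (X - Y) := by simp [hv]
  rw [e1] at hgr
  refine hgr.trans (le_of_eq ?_)
  simp only [sub_zero, mul_one, zero_mul, zero_add]
  field_simp

end IsGoodBall

variable (E G) in
-- The factor 3(exp(Kρ) - 1) in `norm_flow_sub_le` tends to 0 with ρ, which is exactly the little-o
-- condition at the pair (0, 0).
theorem hasStrictFDerivAt_chart_exp :
    HasStrictFDerivAt (fun X : E => chartOne E G (flow G X 1))
      ((ContinuousLinearEquiv.refl ℝ E : E ≃L[ℝ] E) : E →L[ℝ] E) 0 := by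
  obtain ⟨r, K, h⟩ := exists_isGoodBall E G
  rw [hasStrictFDerivAt_iff_isLittleO, Asymptotics.isLittleO_iff]
  intro c hc
  have hlim : Filter.Tendsto (fun ρ : ℝ => 3 * (Real.exp (K * ρ) - 1)) (𝓝 0) (𝓝 0) := by
    have : Continuous fun ρ : ℝ => 3 * (Real.exp (K * ρ) - 1) := by fun_prop
    simpa using this.tendsto 0
  have h1 : ∀ᶠ ρ in 𝓝[>] (0 : ℝ), 3 * (Real.exp (K * ρ) - 1) < c :=
    (hlim.eventually (gt_mem_nhds hc)).filter_mono nhdsWithin_le_nhds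
  have h2 : ∀ᶠ ρ in 𝓝[>] (0 : ℝ), ρ < r / 4 :=
    (gt_mem_nhds (by linarith [h.r_pos])).filter_mono nhdsWithin_le_nhds
  obtain ⟨ρ, ⟨hρc, hρr⟩, hρ⟩ := ((h1.and h2).and self_mem_nhdsWithin).exists
  rw [nhds_prod_eq]
  filter_upwards [Filter.prod_mem_prod (Metric.closedBall_mem_nhds (0 : E) hρ)
    (Metric.closedBall_mem_nhds (0 : E) hρ)]
  rintro ⟨X, Y⟩ ⟨hX, hY⟩
  rw [mem_closedBall_zero_iff] at hX hY
  refine (h.norm_flow_sub_le hρ (by linarith) hX hY).trans ?_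
  gcongr

end ExpEstimates

/-! ### Local inverse of exp, and continuous one-parameter subgroups -/

section OneParameter

open Topology

variable {E : Type*} [NormedAddCommGroup E] [NormedSpace ℝ E]
  [CompleteSpace E]
  {G : Type*} [TopologicalSpace G] [T2Space G] [Group G] [ChartedSpace E G]
  [LieGroup 𝓘(ℝ, E) ∞ G]

/-- The velocity at time 0, read in the chart, recovers the vector. -/
theorem flow_injective : Function.Injective (flow G : E → ℝ → G) := fun X Y h => by
  have h1 := hasDerivAt_chart_flow_zero (G := G) X
  rw [h] at h1
  exact h1.unique (hasDerivAt_chart_flow_zero Y)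

theorem flow_natCast (X : E) (n : ℕ) : flow G X n = flow G X 1 ^ n := by
  induction n with
  | zero => simp [flow_zero]
  | succ n ih => rw [Nat.cast_succ, flow_add, ih, pow_succ]

variable (E G) in
/-- The exponential map is a local homeomorphism at `0`. -/
theorem exists_exp_openPartialHomeomorph [FiniteDimensional ℝ E] :
    ∃ L : OpenPartialHomeomorph E G, 0 ∈ L.source ∧ ∀ X ∈ L.source, L X = flow G X 1 := by
  obtain ⟨r, K, h⟩ := exists_isGoodBall E G
  have hd := hasStrictFDerivAt_chart_exp E G
  -- The inverse function theorem applies to exp read in the chart. Composition with the inverse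
  -- chart gives back exp itself only where exp stays in the chart domain, hence the restriction to
  -- the ball of radius r/4 below.
  let L := (hd.toOpenPartialHomeomorph _).trans (chartAt E (1 : G)).symm
  have hL (X : E) (hX : X ∈ Metric.ball (0 : E) (r / 4)) :
      flow G X 1 ∈ (chartAt E (1 : G)).source := by
    rw [mem_ball_zero_iff] at hX
    have := (h.flow_mem (X := X) (by linarith) (t := 1) (by simp)).1
    rwa [extChartAt_source] at this
  have hr : (0 : E) ∈ Metric.ball (0 : E) (r / 4) :=
    Metric.mem_ball_self (by linarith [h.r_pos])
  refine ⟨L.restrOpen (Metric.ball 0 (r / 4)) Metric.isOpen_ball, ⟨⟨?_, ?_⟩, hr⟩, fun X hX => ?_⟩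
  · exact hd.mem_toOpenPartialHomeomorph_source
  · exact (chartAt E (1 : G)).map_source (hL 0 hr)
  · exact (chartAt E (1 : G)).left_inv (hL X hX.2)

variable (E G) in
-- Continuity near 0 spreads everywhere through exp(Y) = exp(Y/n)ⁿ, with n so large that X/n lies
-- where exp is a local homeomorphism.
theorem continuous_exp [FiniteDimensional ℝ E] [IsTopologicalGroup G] :
    Continuous fun X : E => flow G X 1 := by
  obtain ⟨L, h0, hL⟩ := exists_exp_openPartialHomeomorph E G
  refine continuous_iff_continuousAt.2 fun X => ?_
  obtain ⟨n, hn, hnX⟩ : ∃ n : ℕ, n ≠ 0 ∧ (n : ℝ)⁻¹ • X ∈ L.source := by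
    have h1 : Filter.Tendsto (fun n : ℕ => (n : ℝ)⁻¹ • X) Filter.atTop (𝓝 ((0 : ℝ) • X)) :=
      tendsto_inv_atTop_nhds_zero_nat.smul_const X
    rw [zero_smul] at h1
    obtain ⟨n, h2, h3⟩ :=
      ((h1.eventually (L.open_source.mem_nhds h0)).and (Filter.eventually_ne_atTop 0)).exists
    exact ⟨n, h3, h2⟩
  have e (Y : E) : flow G Y 1 = flow G ((n : ℝ)⁻¹ • Y) 1 ^ n := by
    rw [← flow_natCast, flow_smul, mul_inv_cancel₀ (Nat.cast_ne_zero.2 hn)]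
  have hc : ContinuousAt (fun Y : E => flow G Y 1) ((n : ℝ)⁻¹ • X) := by
    refine (L.continuousAt hnX).congr ?_
    filter_upwards [L.open_source.mem_nhds hnX] with Y hY using hL Y hY
  have hc' : ContinuousAt (fun Y : E => flow G ((n : ℝ)⁻¹ • Y) 1) X :=
    ContinuousAt.comp (f := fun Y : E => (n : ℝ)⁻¹ • Y) hc (by fun_prop)
  rw [funext e]
  exact hc'.pow n

/-- A continuous one-parameter subgroup is determined by a small value, through the local inverse
`L.symm` of the exponential map. -/
theorem eq_flow_of_mem {L : OpenPartialHomeomorph E G} (hL : ∀ X ∈ L.source, L X = flow G X 1)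
    {r : ℝ} (hr : Metric.ball 0 r ⊆ L.source) {σ : ℝ → G} (hσ : Continuous σ)
    (hadd : ∀ s t, σ (s + t) = σ s * σ t) {ε : ℝ} (hε : 0 < ε)
    (hmem : ∀ t ∈ Set.Icc 0 ε, σ t ∈ L '' Metric.ball 0 (r / 2)) :
    σ = flow G (ε⁻¹ • L.symm (σ ε)) := by
  set Y := L.symm (σ ε) with hY
  have hhalf : Metric.ball (0 : E) (r / 2) ⊆ Metric.ball 0 r := by
    rcases le_total 0 r with h | h
    · exact Metric.ball_subset_ball (by linarith)
    · rw [Metric.ball_eq_empty.2 (by linarith)]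
      exact Set.empty_subset _
  have hlog (t : ℝ) (ht : t ∈ Set.Icc 0 ε) :
      L.symm (σ t) ∈ Metric.ball 0 (r / 2) ∧ flow G (L.symm (σ t)) 1 = σ t := by
    obtain ⟨Z, hZ, e⟩ := hmem t ht
    have hZs := hr (hhalf hZ)
    rw [← e, L.left_inv hZs]
    exact ⟨hZ, (hL Z hZs).symm⟩
  have hpow (n : ℕ) : ε / 2 ^ n ∈ Set.Icc 0 ε :=
    ⟨by positivity, div_le_self hε.le (one_le_pow₀ one_le_two)⟩
  -- Each halving of time halves the logarithm. If Z is the logarithm at half the time, 2Z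
  -- exponentiates to the value at the full time, and 2Z is still in the ball of radius r, where L
  -- is injective. This is why the values are required to lie over the ball of radius r/2.
  have hdyad (n : ℕ) : L.symm (σ (ε / 2 ^ n)) = ((2 : ℝ) ^ n)⁻¹ • Y := by
    induction n with
    | zero => simp [hY]
    | succ n ih =>
      obtain ⟨h1, h2⟩ := hlog _ (hpow (n + 1))
      set Z := L.symm (σ (ε / 2 ^ (n + 1))) with hZ
      have h3 : (2 : ℝ) • Z ∈ Metric.ball (0 : E) r := by
        rw [mem_ball_zero_iff] at h1 ⊢
        rw [norm_smul, Real.norm_ofNat]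
        linarith
      have h4 : L ((2 : ℝ) • Z) = σ (ε / 2 ^ n) := by
        rw [hL _ (hr h3), flow_smul, one_mul, ← one_add_one_eq_two, flow_add, h2, ← hadd]
        congr 1
        rw [pow_succ]
        field_simp
        ring
      have h5 : (2 : ℝ) • Z = ((2 : ℝ) ^ n)⁻¹ • Y := by
        rw [← ih, ← h4, L.left_inv (hr h3)]
      rw [pow_succ, mul_inv, mul_comm, mul_smul, ← h5, smul_smul, inv_mul_cancel₀ two_ne_zero,
        one_smul]
  have hσ0 : σ 0 = 1 := by simpa using hadd 0 0
  -- The times at which the two homomorphisms agree form a closed subgroup of ℝ. It contains all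
  -- ε/2ⁿ, so it is dense, hence everything.
  let S : AddSubgroup ℝ :=
    { carrier := {t | σ t = flow G (ε⁻¹ • Y) t}
      zero_mem' := by
        change σ 0 = flow G (ε⁻¹ • Y) 0
        rw [hσ0, flow_zero]
      add_mem' := by
        intro s t hs ht
        change σ (s + t) = flow G (ε⁻¹ • Y) (s + t)
        rw [hadd, flow_add, show σ s = _ from hs, show σ t = _ from ht]
      neg_mem' := by
        intro t ht
        change σ (-t) = flow G (ε⁻¹ • Y) (-t)
        have h1 : σ (-t) * σ t = 1 := by rw [← hadd, neg_add_cancel, hσ0]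
        have h2 : flow G (ε⁻¹ • Y) (-t) * flow G (ε⁻¹ • Y) t = 1 := by
          rw [← flow_add, neg_add_cancel, flow_zero]
        rw [eq_inv_of_mul_eq_one_left h1, eq_inv_of_mul_eq_one_left h2,
          show σ t = _ from ht] }
  have hdense : Dense (S : Set ℝ) := by
    refine AddSubgroup.dense_of_not_isolated_zero S fun δ hδ => ?_
    obtain ⟨n, hn⟩ := exists_pow_lt_of_lt_one (div_pos hδ hε) (by norm_num : (1 / 2 : ℝ) < 1)
    refine ⟨ε / 2 ^ n, ?_, by positivity, ?_⟩
    · change σ _ = flow G (ε⁻¹ • Y) _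
      rw [← (hlog _ (hpow n)).2, hdyad, flow_smul, flow_smul]
      congr 1
      field_simp
    · rw [lt_div_iff₀ hε] at hn
      calc ε / 2 ^ n = (1 / 2) ^ n * ε := by rw [one_div, inv_pow]; ring
        _ < δ := hn
  have hclosed : IsClosed {t | σ t = flow G (ε⁻¹ • Y) t} :=
    isClosed_eq hσ (continuous_flow _)
  funext t
  exact hclosed.closure_subset_iff.2 (subset_refl _) (hdense t)

end OneParameter

open Topology

theorem map_commProd {G H : Type*} [Group G] [Group H] (f : G →* H) {k : ℕ}
    (V : Fin k → G × G) : f (commProd V) = commProd fun j => (f (V j).1, f (V j).2) := by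
  unfold commProd
  rw [map_list_prod, List.map_ofFn]
  congr 2
  funext j
  simp

/-! ### The group Γ_ℝ and its topology -/

namespace SurfGamma

variable {k : ℕ}

theorem J_mul_J (r s : ℝ) : (of (.J r) * of (.J s) : SurfGamma k) = of (.J (r + s)) :=
  PresentedGroup.mk_eq_mk_of_mul_inv_mem (rels := surfRels k) (Or.inl ⟨r, s, rfl⟩)

theorem A_mul_J (j : Fin k) (r : ℝ) :
    (of (.A j) * of (.J r) : SurfGamma k) = of (.J r) * of (.A j) :=
  commutatorElement_eq_one_iff_mul_comm.1
    (PresentedGroup.one_of_mem (rels := surfRels k) (Or.inr (Or.inl ⟨j, r, rfl⟩)))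

theorem B_mul_J (j : Fin k) (r : ℝ) :
    (of (.B j) * of (.J r) : SurfGamma k) = of (.J r) * of (.B j) :=
  commutatorElement_eq_one_iff_mul_comm.1
    (PresentedGroup.one_of_mem (rels := surfRels k) (Or.inr (Or.inr (Or.inl ⟨j, r, rfl⟩))))

theorem commProd_eq : commProd (fun j : Fin k => (of (.A j), of (.B j))) = of (.J 1) := by
  have h := PresentedGroup.mk_eq_mk_of_mul_inv_mem (rels := surfRels k)
    (Or.inr (Or.inr (Or.inr rfl)))
  rw [map_commProd] at h
  exact h

theorem continuous_J_mul (x : SurfGamma k) : Continuous fun r : ℝ => of (.J r) * x :=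
  continuous_iff_coinduced_le.2
    (le_iSup (fun x : SurfGamma k => TopologicalSpace.coinduced (fun r : ℝ => of (.J r) * x) _) x)

theorem J_zero : (of (.J 0) : SurfGamma k) = 1 := by
  simpa using J_mul_J (k := k) 0 0

theorem continuous_J : Continuous fun r : ℝ => (of (.J r) : SurfGamma k) := by
  simpa using continuous_J_mul (1 : SurfGamma k)

theorem continuous_dom_iff {T : Type*} [TopologicalSpace T] {f : SurfGamma k → T} :
    Continuous f ↔ ∀ x, Continuous fun r : ℝ => f (of (.J r) * x) := by
  refine continuous_iSup_dom.trans (forall_congr' fun x => ?_)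
  exact continuous_coinduced_dom

/-- If J_u x = J_r y, then J_{r'} y = J_{r' - r + u} x for all r', so the preimage of the image
under any other parametrization is a neighbourhood of each of its points. Hence neighbourhoods in
Γ_ℝ can be described by small r alone. -/
theorem isOpenMap_J_mul (x : SurfGamma k) : IsOpenMap fun r : ℝ => of (.J r) * x := by
  intro U hU
  refine isOpen_iSup_iff.2 fun y => isOpen_coinduced.2 (isOpen_iff_mem_nhds.2 ?_)
  rintro r ⟨u, hu, e⟩
  have hc : Continuous fun r' : ℝ => (r' - r) + u := by fun_prop
  have hn : U ∈ 𝓝 ((r - r) + u) := by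
    rw [sub_self, zero_add]
    exact hU.mem_nhds hu
  filter_upwards [hc.continuousAt.preimage_mem_nhds hn] with r' hr'
  refine ⟨(r' - r) + u, hr', ?_⟩
  change of (.J _) * x = of (.J r') * y
  change of (.J u) * x = of (.J r) * y at e
  rw [← J_mul_J, mul_assoc, e, ← mul_assoc, J_mul_J, sub_add_cancel]

theorem hom_ext {G : Type*} [Group G] {φ ψ : SurfGamma k →* G}
    (h : ∀ x, φ (of x) = ψ (of x)) : φ = ψ :=
  PresentedGroup.ext (rels := surfRels k) h

end SurfGamma

/-! ### Points of X_YM and continuous homomorphisms -/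

section SurfHom

variable {E : Type*} [NormedAddCommGroup E] [NormedSpace ℝ E] [CompleteSpace E]
  {G : Type*} [TopologicalSpace G] [T2Space G] [Group G] [ChartedSpace E G]
  [LieGroup 𝓘(ℝ, E) ∞ G] {k : ℕ}

theorem lieExp_smul_eq_flow (X : LieAlg E G) (r : ℝ) : lieExp (r • X) = flow G (E := E) X r :=
  lieExp_smul X r

/-- The images of the generators of `Γ_ℝ(Σ)` under the homomorphism that corresponds to a point of
`X_YM`. -/
def genImage (x : ymVariety E G k) : SurfGen k → G
  | .A j => (x.1.1 j).1
  | .B j => (x.1.1 j).2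
  | .J r => lieExp (r • x.1.2)

theorem lift_genImage_eq_one (x : ymVariety E G k) (w : FreeGroup (SurfGen k))
    (hw : w ∈ surfRels k) : FreeGroup.lift (genImage x) w = 1 := by
  obtain ⟨r, s, rfl⟩ | ⟨j, r, rfl⟩ | ⟨j, r, rfl⟩ | rfl := hw
  · simp [genImage, lieExp_add_smul]
  · simp [genImage, lieExp_comm_of_mem_stab (x.2.1 j).1]
  · simp [genImage, lieExp_comm_of_mem_stab (x.2.1 j).2]
  · rw [map_mul, map_commProd]
    simp only [FreeGroup.lift_apply_of, map_inv, genImage, one_smul]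
    rw [← x.2.2]
    exact mul_inv_cancel _

/-- The homomorphism `Γ_ℝ(Σ) → G` that corresponds to a point of `X_YM`. -/
def ymMonoidHom (x : ymVariety E G k) : SurfGamma k →* G :=
  PresentedGroup.toGroup (lift_genImage_eq_one x)

theorem ymMonoidHom_of (x : ymVariety E G k) (g : SurfGen k) :
    ymMonoidHom x (.of g) = genImage x g :=
  PresentedGroup.toGroup.of _

variable [IsTopologicalGroup G]

/-- The continuous homomorphism `Γ_ℝ(Σ) → G` that corresponds to a point of `X_YM`. -/
def ymHom (x : ymVariety E G k) : SurfHom k G where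
  toMonoidHom := ymMonoidHom x
  continuous_toFun := by
    refine SurfGamma.continuous_dom_iff.2 fun y => ?_
    change Continuous fun r => ymMonoidHom x (_ * y)
    simp only [map_mul, ymMonoidHom_of, genImage, lieExp_smul_eq_flow]
    exact (continuous_flow (E := E) x.1.2).mul continuous_const

theorem ymHom_of (x : ymVariety E G k) (g : SurfGen k) : ymHom x (.of g) = genImage x g :=
  ymMonoidHom_of x g

theorem corresponds_ymHom (x : ymVariety E G k) : Corresponds x (ymHom x) :=
  ⟨fun j => ⟨ymHom_of x (.A j), ymHom_of x (.B j)⟩, fun r => ymHom_of x (.J r)⟩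

omit [T2Space G] [IsTopologicalGroup G] in
theorem surfHom_ext {ρ ρ' : SurfHom k G} (h : ∀ x, ρ (.of x) = ρ' (.of x)) : ρ = ρ' := by
  have := SurfGamma.hom_ext (φ := ρ.toMonoidHom) (ψ := ρ'.toMonoidHom) h
  ext y
  exact DFunLike.congr_fun this y

omit [T2Space G] in
theorem smul_surfHom_apply (g : G) (ρ : SurfHom k G) (y : SurfGamma k) :
    (g • ρ) y = g * ρ y * g⁻¹ := rfl

theorem ymHom_smul (g : G) (x : ymVariety E G k) : ymHom (g • x) = g • ymHom x := by
  refine surfHom_ext fun w => ?_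
  rw [smul_surfHom_apply, ymHom_of, ymHom_of]
  cases w with
  | A j => rfl
  | B j => rfl
  | J r =>
    change lieExp (r • Ad E g x.1.2) = _
    rw [← map_smul, lieExp_Ad]
    rfl

omit [IsTopologicalGroup G] in
theorem eq_of_corresponds {x y : ymVariety E G k} {ρ : SurfHom k G} (hx : Corresponds x ρ)
    (hy : Corresponds y ρ) : x = y := by
  refine Subtype.ext (Prod.ext (funext fun j => Prod.ext ?_ ?_) ?_)
  · rw [← (hx.1 j).1, (hy.1 j).1]
  · rw [← (hx.1 j).2, (hy.1 j).2]
  · refine flow_injective (E := E) (G := G) (funext fun r => ?_)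
    have h := (hx.2 r).symm.trans (hy.2 r)
    rwa [lieExp_smul_eq_flow, lieExp_smul_eq_flow] at h

theorem eq_ymHom_of_corresponds {x : ymVariety E G k} {ρ : SurfHom k G} (h : Corresponds x ρ) :
    ρ = ymHom x := by
  refine surfHom_ext fun w => ?_
  rw [ymHom_of]
  cases w with
  | A j => exact (h.1 j).1
  | B j => exact (h.1 j).2
  | J r => exact h.2 r

omit [T2Space G] [IsTopologicalGroup G] in
theorem surfHom_J_add (ρ : SurfHom k G) (s t : ℝ) :
    ρ (.of (.J (s + t))) = ρ (.of (.J s)) * ρ (.of (.J t)) := by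
  rw [← SurfGamma.J_mul_J, map_mul]

omit [T2Space G] [IsTopologicalGroup G] in
theorem continuous_surfHom_J (ρ : SurfHom k G) : Continuous fun r : ℝ => ρ (.of (.J r)) :=
  ρ.continuous_toFun.comp SurfGamma.continuous_J

omit [T2Space G] [IsTopologicalGroup G] in
theorem exists_surfHom_J_mem (ρ : SurfHom k G) {U : Set G} (hU : IsOpen U) (h1 : 1 ∈ U) :
    ∃ ε > 0, ∀ t ∈ Set.Icc (0 : ℝ) ε, ρ (.of (.J t)) ∈ U := by
  have h0 : ρ (.of (.J 0)) ∈ U := by rwa [SurfGamma.J_zero, map_one]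
  obtain ⟨ε, hε, hball⟩ := Metric.isOpen_iff.1 (hU.preimage (continuous_surfHom_J ρ)) 0 h0
  refine ⟨ε / 2, half_pos hε, fun t ht => hball ?_⟩
  rw [Metric.mem_ball, Real.dist_eq, sub_zero, abs_of_nonneg ht.1]
  linarith [ht.2]

omit [IsTopologicalGroup G] in
/-- A homomorphism whose restriction to the `J_r` is generated by `X` corresponds to a point of
`X_YM`. -/
theorem exists_corresponds_of_flow {ρ : SurfHom k G} {X : E}
    (hX : ∀ r, ρ (.of (.J r)) = flow G X r) :
    ∃ x : ymVariety E G k, Corresponds x ρ ∧ x.1.2 = X := by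
  -- The one-parameter subgroup of Ad(ρ(a))X is the conjugate of that of X by ρ(a). As a commutes
  -- with all J_r, the two agree, and so do their generators.
  have hstab (a : SurfGamma k) (ha : ∀ r, a * .of (.J r) = .of (.J r) * a) :
      ρ a ∈ stab E (show LieAlg E G from X) := by
    refine mem_stab.2 (flow_injective (E := E) (G := G) (funext fun r => ?_))
    have h1 := lieExp_Ad (ρ a) (r • (show LieAlg E G from X))
    rw [map_smul, lieExp_smul_eq_flow, lieExp_smul_eq_flow] at h1
    refine h1.trans ?_
    have h2 := congrArg ρ (ha r)
    rw [map_mul, map_mul, hX] at h2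
    exact mul_inv_eq_of_eq_mul h2
  refine ⟨⟨(fun j => (ρ (.of (.A j)), ρ (.of (.B j))), X), fun j =>
    ⟨hstab _ (SurfGamma.A_mul_J j), hstab _ (SurfGamma.B_mul_J j)⟩, ?_⟩,
    ⟨fun j => ⟨rfl, rfl⟩, fun r => ?_⟩, rfl⟩
  · have h := congrArg ρ.toMonoidHom (SurfGamma.commProd_eq (k := k))
    rw [map_commProd] at h
    exact h.trans (hX 1)
  · rw [lieExp_smul_eq_flow]
    exact hX r

variable [FiniteDimensional ℝ E]

omit [IsTopologicalGroup G] in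
variable (E G) in
theorem exists_exp_nhds : ∃ (L : OpenPartialHomeomorph E G) (r : ℝ),
    (∀ X ∈ L.source, L X = flow G X 1) ∧ Metric.ball 0 r ⊆ L.source ∧
      L '' Metric.ball 0 (r / 2) ⊆ L.target ∧ IsOpen (L '' Metric.ball 0 (r / 2)) ∧
      (1 : G) ∈ L '' Metric.ball 0 (r / 2) := by
  obtain ⟨L, h0, hL⟩ := exists_exp_openPartialHomeomorph E G
  obtain ⟨r, hr, hrL⟩ := Metric.isOpen_iff.1 L.open_source 0 h0
  have hsub : Metric.ball 0 (r / 2) ⊆ L.source :=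
    (Metric.ball_subset_ball (by linarith)).trans hrL
  refine ⟨L, r, hL, hrL, ?_, L.isOpen_image_of_subset_source Metric.isOpen_ball hsub,
    0, Metric.mem_ball_self (by linarith), ?_⟩
  · rintro _ ⟨X, hX, rfl⟩
    exact L.map_source (hsub hX)
  · rw [hL 0 h0, ← zero_smul ℝ (0 : E), flow_smul, mul_zero, flow_zero]

omit [IsTopologicalGroup G] in
-- The path r ↦ ρ(J_r) starts at 1, so it lies in the exponential neighbourhood for small r ≥ 0;
-- `eq_flow_of_mem` then supplies its generator.
theorem exists_corresponds (ρ : SurfHom k G) : ∃ x : ymVariety E G k, Corresponds x ρ := by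
  obtain ⟨L, r, hL, hrL, -, hopen, h1⟩ := exists_exp_nhds E G
  obtain ⟨ε, hε, hmem⟩ := exists_surfHom_J_mem ρ hopen h1
  have h := eq_flow_of_mem hL hrL (continuous_surfHom_J ρ) (surfHom_J_add ρ) hε hmem
  obtain ⟨x, hx, -⟩ := exists_corresponds_of_flow (congrFun h)
  exact ⟨x, hx⟩

theorem continuous_genImage (g : SurfGen k) :
    Continuous fun x : ymVariety E G k => genImage x g := by
  cases g with
  | A j => exact ((continuous_apply j).comp (continuous_fst.comp continuous_subtype_val)).fst
  | B j => exact ((continuous_apply j).comp (continuous_fst.comp continuous_subtype_val)).snd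
  | J r =>
    have h : Continuous fun x : ymVariety E G k => (r • x.1.2 : LieAlg E G) :=
      (continuous_snd.comp continuous_subtype_val).const_smul r
    exact (continuous_exp E G).comp h

/-- The elements y with continuous evaluation form a subgroup, and it contains the generators. -/
theorem continuous_ymMonoidHom_apply (y : SurfGamma k) :
    Continuous fun x : ymVariety E G k => ymMonoidHom x y := by
  let H : Subgroup (SurfGamma k) :=
    { carrier := {y | Continuous fun x : ymVariety E G k => ymMonoidHom x y}
      one_mem' := by simpa using continuous_const
      mul_mem' := fun {a b} ha hb => by
        change Continuous fun x : ymVariety E G k => ymMonoidHom x (a * b)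
        simp only [map_mul]
        exact Continuous.mul ha hb
      inv_mem' := fun {a} ha => by
        change Continuous fun x : ymVariety E G k => ymMonoidHom x a⁻¹
        simp only [map_inv]
        exact Continuous.inv ha }
  refine PresentedGroup.generated_by (surfRels k) H (fun g => ?_) y
  change Continuous fun x : ymVariety E G k => ymMonoidHom x (SurfGamma.of g)
  simpa only [ymMonoidHom_of] using continuous_genImage g

theorem continuous_lieExp_smul :
    Continuous fun p : ymVariety E G k × ℝ => lieExp (p.2 • p.1.1.2) := by
  have h : Continuous fun p : ymVariety E G k × ℝ => (p.2 • p.1.1.2 : LieAlg E G) :=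
    continuous_snd.smul (continuous_snd.comp (continuous_subtype_val.comp continuous_fst))
  exact (continuous_exp E G).comp h

/-- For the compact-open topology joint continuity in (x, y) is enough. Near y₀ every element is J_r
y₀ with small r, where the value is exp(rX) times the value at y₀, and both factors are continuous.
-/
theorem continuous_ymHom : Continuous (ymHom : ymVariety E G k → SurfHom k G) := by
  refine (ContinuousMonoidHom.isInducing_toContinuousMap _ _).continuous_iff.2
    (ContinuousMap.continuous_of_continuous_uncurry _ ?_)
  refine continuous_iff_continuousAt.2 ?_
  rintro ⟨x₀, y₀⟩
  have hc : Continuous fun p : ymVariety E G k × ℝ =>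
      lieExp (p.2 • p.1.1.2) * ymMonoidHom p.1 y₀ :=
    continuous_lieExp_smul.mul ((continuous_ymMonoidHom_apply y₀).comp continuous_fst)
  have hJ (x : ymVariety E G k) (r : ℝ) :
      ymMonoidHom x (.of (.J r) * y₀) = lieExp (r • x.1.2) * ymMonoidHom x y₀ := by
    rw [map_mul, ymMonoidHom_of]
    rfl
  have h0 : lieExp ((0 : ℝ) • x₀.1.2) * ymMonoidHom x₀ y₀ = ymMonoidHom x₀ y₀ := by
    rw [← hJ, SurfGamma.J_zero, one_mul]
  intro W hW
  have h1 := hc.continuousAt (x := (x₀, (0 : ℝ))).preimage_mem_nhds (t := W) (by rw [h0]; exact hW)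
  rw [nhds_prod_eq] at h1
  obtain ⟨A, hA, U, hU, hAU⟩ := Filter.mem_prod_iff.1 h1
  have h2 : (fun r : ℝ => SurfGamma.of (.J r) * y₀) '' U ∈ 𝓝 y₀ := by
    have := (SurfGamma.isOpenMap_J_mul y₀).image_mem_nhds hU
    rwa [SurfGamma.J_zero, one_mul] at this
  rw [Filter.mem_map]
  filter_upwards [prod_mem_nhds hA h2]
  rintro ⟨x, _⟩ ⟨hx, r, hr, rfl⟩
  change ymMonoidHom x (.of (.J r) * y₀) ∈ W
  rw [hJ]
  exact hAU (Set.mk_mem_prod hx hr)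

omit [IsTopologicalGroup G] in
-- The group entries are evaluations of ρ. The vector X equals ε⁻¹ log ρ(J_ε), with one ε valid for
-- all ρ near a given ρ₀.
theorem continuous_of_corresponds {s : SurfHom k G → ymVariety E G k}
    (hs : ∀ ρ, Corresponds (s ρ) ρ) : Continuous s := by
  have heval (y : SurfGamma k) : Continuous fun ρ : SurfHom k G => ρ y :=
    (continuous_eval_const (F := C(SurfGamma k, G)) y).comp
      (ContinuousMonoidHom.isInducing_toContinuousMap _ _).continuous
  refine Continuous.subtype_mk (Continuous.prodMk (f := fun ρ => (s ρ).1.1)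
    (g := fun ρ => (s ρ).1.2) (continuous_pi fun j => Continuous.prodMk ?_ ?_) ?_) _
  · simpa only [← ((hs _).1 j).1] using heval (.of (.A j))
  · simpa only [← ((hs _).1 j).2] using heval (.of (.B j))
  · obtain ⟨L, r, hL, hrL, htgt, hopen, h1⟩ := exists_exp_nhds E G
    refine continuous_iff_continuousAt.2 fun ρ₀ => ?_
    obtain ⟨ε, hε, hmem⟩ := exists_surfHom_J_mem ρ₀ hopen h1
    -- Sending the compact arc of the J_t with 0 ≤ t ≤ ε into the open exponential neighbourhood is
    -- an open condition on ρ, so the same ε serves nearby homomorphisms.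
    have hN : {f : C(SurfGamma k, G) | Set.MapsTo f ((fun r : ℝ => .of (.J r)) '' Set.Icc 0 ε)
        (L '' Metric.ball 0 (r / 2))} ∈ 𝓝 (ContinuousMonoidHom.toContinuousMap ρ₀) := by
      refine (ContinuousMap.isOpen_setOfPred_mapsTo
        (isCompact_Icc.image SurfGamma.continuous_J) hopen).mem_nhds ?_
      rintro _ ⟨t, ht, rfl⟩
      exact hmem t ht
    have hN' := (ContinuousMonoidHom.isInducing_toContinuousMap _ _).continuous.continuousAt
      |>.preimage_mem_nhds hN
    have hc : ContinuousAt (fun ρ : SurfHom k G => ε⁻¹ • L.symm (ρ (.of (.J ε)))) ρ₀ := by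
      refine ContinuousAt.const_smul (ContinuousAt.comp (g := L.symm) ?_ (heval _).continuousAt) _
      exact L.symm.continuousAt (htgt (hmem ε ⟨hε.le, le_rfl⟩))
    refine hc.congr ?_
    filter_upwards [hN'] with ρ hρ
    have h := eq_flow_of_mem hL hrL (continuous_surfHom_J ρ) (surfHom_J_add ρ) hε
      fun t ht => hρ ⟨t, ht, rfl⟩
    refine flow_injective (E := E) (G := G) (h.symm.trans (funext fun t => ?_))
    rw [(hs ρ).2, lieExp_smul_eq_flow]

variable (E G k) in
theorem exists_ymHom_homeomorph :
    ∃ h : MulAction.orbitRel.Quotient G (ymVariety E G k) ≃ₜ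
        MulAction.orbitRel.Quotient G (SurfHom k G),
      ∀ x : ymVariety E G k, ∃ ρ : SurfHom k G,
        Corresponds x ρ ∧ h (Quotient.mk _ x) = Quotient.mk _ ρ := by
  -- The choice is forced, since ρ determines its point by `eq_of_corresponds`. Hence s is
  -- equivariant and inverse to `ymHom` even before passing to orbits.
  choose s hs using exists_corresponds (E := E) (G := G) (k := k)
  have hs1 (x : ymVariety E G k) : s (ymHom x) = x :=
    eq_of_corresponds (hs _) (corresponds_ymHom x)
  have hs2 (ρ : SurfHom k G) : ymHom (s ρ) = ρ := (eq_ymHom_of_corresponds (hs ρ)).symm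
  have hsg (g : G) (ρ : SurfHom k G) : s (g • ρ) = g • s ρ := by
    rw [← hs1 (g • s ρ), ymHom_smul, hs2]
  let F := orbitMap G G (ymHom (E := E) (G := G) (k := k)) continuous_ymHom
    fun g x => ⟨g, ymHom_smul g x⟩
  let B := orbitMap G G s (continuous_of_corresponds hs) fun g ρ => ⟨g, hsg g ρ⟩
  refine ⟨⟨⟨F, B, ?_, ?_⟩, F.continuous, B.continuous⟩,
    fun x => ⟨ymHom x, corresponds_ymHom x, rfl⟩⟩
  · rintro ⟨x⟩
    exact congrArg (Quotient.mk _) (hs1 x)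
  · rintro ⟨ρ⟩
    exact congrArg (Quotient.mk _) (hs2 ρ)

end SurfHom

/-! ### Splitting and joining tuples -/

section TupleHalves

variable {G : Type*} [Group G] {k ℓ : ℕ}

/-- The first `k` pairs of a tuple. -/
def tupleLeft (V : Fin (k + ℓ) → G × G) : Fin k → G × G := fun i => V (Fin.castAdd ℓ i)

/-- The last `ℓ` pairs of a tuple. -/
def tupleRight (V : Fin (k + ℓ) → G × G) : Fin ℓ → G × G := fun i => V (Fin.natAdd k i)

omit [Group G] in
theorem append_left_right (V : Fin (k + ℓ) → G × G) :
    Fin.append (tupleLeft V) (tupleRight V) = V := Fin.append_castAdd_natAdd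

omit [Group G] in
theorem tupleLeft_append (V : Fin k → G × G) (W : Fin ℓ → G × G) :
    tupleLeft (Fin.append V W) = V := funext fun i => Fin.append_left V W i

omit [Group G] in
theorem tupleRight_append (V : Fin k → G × G) (W : Fin ℓ → G × G) :
    tupleRight (Fin.append V W) = W := funext fun i => Fin.append_right V W i

theorem commProd_left_mul_right (V : Fin (k + ℓ) → G × G) :
    commProd (tupleLeft V) * commProd (tupleRight V) = commProd V := by
  rw [← commProd_append, append_left_right]

theorem commProd_init_mul_last (V : Fin (k + 1) → G × G) :
    commProd (Fin.init V : Fin k → G × G) * ((V (Fin.last k)).1 * (V (Fin.last k)).2 *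
      (V (Fin.last k)).1⁻¹ * (V (Fin.last k)).2⁻¹) = commProd V := by
  rw [← commProd_snoc, Fin.snoc_init_self]

omit [Group G] in
theorem revTuple_revTuple (V : Fin k → G × G) : revTuple (revTuple V) = V := by
  funext j; simp [revTuple]

theorem conjTuple_inv_conjTuple (g : G) (V : Fin k → G × G) :
    conjTuple g⁻¹ (conjTuple g V) = V := by
  rw [← conjTuple_mul, inv_mul_cancel, conjTuple_one]

variable [TopologicalSpace G] [IsTopologicalGroup G] {Y : Type*} [TopologicalSpace Y]

theorem continuous_conjTuple {g : Y → G} {V : Y → Fin k → G × G} (hg : Continuous g)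
    (hV : Continuous V) : Continuous fun y => conjTuple (g y) (V y) :=
  continuous_pi fun j =>
    ((hg.mul ((continuous_apply j).comp hV).fst).mul hg.inv).prodMk
      ((hg.mul ((continuous_apply j).comp hV).snd).mul hg.inv)

theorem continuous_commProd : Continuous (commProd : (Fin k → G × G) → G) := by
  unfold commProd
  simp only [List.ofFn_eq_map]
  exact continuous_list_prod _ fun j _ => by fun_prop

end TupleHalves

section TupleContinuity

variable {G : Type*} [TopologicalSpace G] {k ℓ : ℕ} {Y : Type*} [TopologicalSpace Y]

theorem continuous_revTuple : Continuous (revTuple : (Fin k → G × G) → _) := by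
  unfold revTuple
  fun_prop

theorem continuous_tupleLeft : Continuous (tupleLeft : (Fin (k + ℓ) → G × G) → _) := by
  unfold tupleLeft
  fun_prop

theorem continuous_tupleRight : Continuous (tupleRight : (Fin (k + ℓ) → G × G) → _) := by
  unfold tupleRight
  fun_prop

theorem continuous_append {V : Y → Fin k → G × G} {W : Y → Fin ℓ → G × G} (hV : Continuous V)
    (hW : Continuous W) : Continuous fun y => Fin.append (V y) (W y) := by
  refine continuous_pi fun j => ?_
  refine Fin.addCases (fun i => ?_) (fun i => ?_) j
  · simp only [Fin.append_left]
    exact (continuous_apply i).comp hV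
  · simp only [Fin.append_right]
    exact (continuous_apply i).comp hW

end TupleContinuity

/-! ### Continuity of the actions and of Φ -/

section Actions

variable {E : Type*} [NormedAddCommGroup E] [NormedSpace ℝ E] [CompleteSpace E]
  {G : Type*} [TopologicalSpace G] [T2Space G] [Group G] [ChartedSpace E G]
  [LieGroup 𝓘(ℝ, E) ∞ G] {k ℓ : ℕ}

theorem smul_ym_val (g : G) (x : ymVariety E G k) :
    (g • x).1 = (conjTuple g x.1.1, Ad E g x.1.2) := rfl

theorem smul_zym₁_val (g : G × G) (z : zymVariety₁ E G ℓ) :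
    (g • z).1 = (conjTuple g.1 z.1.1, g.1 * z.1.2.1 * g.2⁻¹, conjTuple g.2 z.1.2.2.1,
      g.2 * z.1.2.2.2.1 * g.1⁻¹, Ad E g.1 z.1.2.2.2.2) := rfl

theorem smul_zym₂_val (g : G × G) (z : zymVariety₂ E G ℓ) :
    (g • z).1 = (conjTuple g.1 z.1.1, g.1 * z.1.2.1 * g.1⁻¹, g.1 * z.1.2.2.1 * g.2⁻¹,
      conjTuple g.2 z.1.2.2.2.1, g.2 * z.1.2.2.2.2.1 * g.2⁻¹, g.2 * z.1.2.2.2.2.2.1 * g.1⁻¹,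
      Ad E g.1 z.1.2.2.2.2.2.2) := rfl

theorem Phi₁_val (z : zymVariety₁ E G ℓ) :
    (Phi₁ ℓ z).1 = (Fin.append z.1.1 (conjTuple z.1.2.1 (revTuple z.1.2.2.1)), z.1.2.2.2.2) := rfl

theorem Phi₂_val (z : zymVariety₂ E G ℓ) :
    (Phi₂ ℓ z).1 = (Fin.snoc (Fin.append z.1.1 (conjTuple (z.1.2.1⁻¹ * z.1.2.2.1)
      (revTuple z.1.2.2.2.1))) (z.1.2.1⁻¹, z.1.2.2.1 * z.1.2.2.2.2.2.1), z.1.2.2.2.2.2.2) := rfl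

variable [IsTopologicalGroup G]

instance : ContinuousConstSMul G (ymVariety E G k) := by
  refine ⟨fun g => continuous_induced_rng.2 ?_⟩
  simp only [Function.comp_def, smul_ym_val]
  exact (continuous_conjTuple continuous_const continuous_subtype_val.fst).prodMk
    ((Ad E g).continuous.comp continuous_subtype_val.snd)

instance : ContinuousConstSMul (G × G) (zymVariety₁ E G ℓ) := by
  refine ⟨fun g => continuous_induced_rng.2 ?_⟩
  simp only [Function.comp_def, smul_zym₁_val]
  have h := continuous_subtype_val (p := (· ∈ zymVariety₁ E G ℓ))
  exact (continuous_conjTuple continuous_const h.fst).prodMk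
    (((continuous_const.mul h.snd.fst).mul continuous_const).prodMk
    ((continuous_conjTuple continuous_const h.snd.snd.fst).prodMk
    (((continuous_const.mul h.snd.snd.snd.fst).mul continuous_const).prodMk
    ((Ad E g.1).continuous.comp h.snd.snd.snd.snd))))

instance : ContinuousConstSMul (G × G) (zymVariety₂ E G ℓ) := by
  refine ⟨fun g => continuous_induced_rng.2 ?_⟩
  simp only [Function.comp_def, smul_zym₂_val]
  have h := continuous_subtype_val (p := (· ∈ zymVariety₂ E G ℓ))
  exact (continuous_conjTuple continuous_const h.fst).prodMk
    (((continuous_const.mul h.snd.fst).mul continuous_const).prodMk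
    (((continuous_const.mul h.snd.snd.fst).mul continuous_const).prodMk
    ((continuous_conjTuple continuous_const h.snd.snd.snd.fst).prodMk
    (((continuous_const.mul h.snd.snd.snd.snd.fst).mul continuous_const).prodMk
    (((continuous_const.mul h.snd.snd.snd.snd.snd.fst).mul continuous_const).prodMk
    ((Ad E g.1).continuous.comp h.snd.snd.snd.snd.snd.snd))))))

theorem continuous_Phi₁ : Continuous (Phi₁ (E := E) (G := G) ℓ) := by
  refine continuous_induced_rng.2 ?_
  simp only [Function.comp_def, Phi₁_val]
  have h := continuous_subtype_val (p := (· ∈ zymVariety₁ E G ℓ))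
  exact (continuous_append h.fst (continuous_conjTuple h.snd.fst
    (continuous_revTuple.comp h.snd.snd.fst))).prodMk h.snd.snd.snd.snd

theorem continuous_Phi₂ : Continuous (Phi₂ (E := E) (G := G) ℓ) := by
  refine continuous_induced_rng.2 ?_
  simp only [Function.comp_def, Phi₂_val]
  have h := continuous_subtype_val (p := (· ∈ zymVariety₂ E G ℓ))
  exact ((continuous_append h.fst (continuous_conjTuple (h.snd.fst.inv.mul h.snd.snd.fst)
    (continuous_revTuple.comp h.snd.snd.snd.fst))).finSnoc
    (h.snd.fst.inv.prodMk (h.snd.snd.fst.mul h.snd.snd.snd.snd.snd.fst))).prodMk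
    h.snd.snd.snd.snd.snd.snd

end Actions

/-! ### Equivariant sections of Φ -/

section Sections

variable {E : Type*} [NormedAddCommGroup E] [NormedSpace ℝ E] [CompleteSpace E]
  {G : Type*} [TopologicalSpace G] [T2Space G] [Group G] [ChartedSpace E G]
  [LieGroup 𝓘(ℝ, E) ∞ G] {ℓ : ℕ}

theorem Phi₁_smul (g : G × G) (z : zymVariety₁ E G ℓ) : Phi₁ ℓ (g • z) = g.1 • Phi₁ ℓ z := by
  refine Subtype.ext ?_
  rw [smul_ym_val, Phi₁_val, Phi₁_val, smul_zym₁_val]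
  refine Prod.ext ?_ rfl
  simp only [conjTuple_append, ← conjTuple_rev, ← conjTuple_mul, inv_mul_cancel_right]

theorem Phi₂_smul (g : G × G) (z : zymVariety₂ E G ℓ) : Phi₂ ℓ (g • z) = g.1 • Phi₂ ℓ z := by
  refine Subtype.ext ?_
  rw [smul_ym_val, Phi₂_val, Phi₂_val, smul_zym₂_val]
  refine Prod.ext ?_ rfl
  have hsnoc (V : Fin (ℓ + ℓ) → G × G) (p : G × G) :
      conjTuple g.1 (Fin.snoc V p : Fin (ℓ + ℓ + 1) → G × G) =
        Fin.snoc (conjTuple g.1 V) (g.1 * p.1 * g.1⁻¹, g.1 * p.2 * g.1⁻¹) := by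
    funext j
    refine Fin.lastCases ?_ (fun i => ?_) j <;> simp [conjTuple]
  simp only [hsnoc, conjTuple_append, ← conjTuple_rev, ← conjTuple_mul]
  rw [show g.1 * z.1.2.2.1 * g.2⁻¹ * (g.2 * z.1.2.2.2.2.2.1 * g.1⁻¹) =
      g.1 * (z.1.2.2.1 * z.1.2.2.2.2.2.1) * g.1⁻¹ by group,
    show (g.1 * z.1.2.1 * g.1⁻¹)⁻¹ * (g.1 * z.1.2.2.1 * g.2⁻¹) * g.2 =
      g.1 * (z.1.2.1⁻¹ * z.1.2.2.1) by group,
    show (g.1 * z.1.2.1 * g.1⁻¹)⁻¹ = g.1 * z.1.2.1⁻¹ * g.1⁻¹ by group]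

/-- A section of `Phi₁`, whose values have the coordinate `c = 1`. -/
def section₁ (x : ymVariety E G (ℓ + ℓ)) : zymVariety₁ E G ℓ :=
  -- With c = 1, V̄ is forced by Φ s = id and c̄ by the first product equation.
  ⟨(tupleLeft x.1.1, 1, revTuple (tupleRight x.1.1),
    lieExp ((-(1 / 2) : ℝ) • x.1.2) * commProd (tupleLeft x.1.1), x.1.2), by
    have h1 : TupleIn (tupleLeft x.1.1) (stab E x.1.2) := fun i => x.2.1 _
    have h2 : TupleIn (tupleRight x.1.1) (stab E x.1.2) := fun i => x.2.1 _
    have hm := lieExp_comm_of_mem_stab h1.commProd_mem (1 / 2 : ℝ)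
    have hx := x.2.2
    rw [← commProd_left_mul_right, ← lieExp_half] at hx
    refine ⟨h1, by rw [conjTuple_one]; exact h2.rev, ?_, ?_⟩
    · rw [lieExp_neg_half]
      group
    -- The second product equation follows from 𝔪 = exp(X), because the commutator product of the
    -- first half commutes with exp(X/2).
    · rw [lieExp_neg_half, commProd_rev, eq_inv_mul_of_mul_eq hx]
      generalize lieExp ((1 / 2 : ℝ) • x.1.2) = a at *
      generalize commProd (tupleLeft x.1.1) = m at *
      have hm' : m * a⁻¹ = a⁻¹ * m := by
        rw [mul_inv_eq_iff_eq_mul, mul_assoc, hm]; group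
      rw [mul_one, mul_assoc a⁻¹ m, hm']
      group⟩

/-- A section of `Phi₂`, whose values have the coordinate `c = 1`. -/
def section₂ (x : ymVariety E G (ℓ + ℓ + 1)) : zymVariety₂ E G ℓ :=
  -- If the last pair is (a, b), then c = 1 and Φ s = id force d = a⁻¹, c̄ = b and V̄. The first
  -- product equation, 𝔪(V) = exp(X/2) d̄ d, is then solved for d̄.
  ⟨(tupleLeft (Fin.init x.1.1), (x.1.1 (Fin.last _)).1⁻¹, 1,
    conjTuple (x.1.1 (Fin.last _)).1⁻¹ (revTuple (tupleRight (Fin.init x.1.1))),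
    lieExp ((-(1 / 2) : ℝ) • x.1.2) * commProd (tupleLeft (Fin.init x.1.1)) *
      (x.1.1 (Fin.last _)).1, (x.1.1 (Fin.last _)).2, x.1.2), by
    have h1 : TupleIn (tupleLeft (Fin.init x.1.1)) (stab E x.1.2) := fun i => x.2.1 _
    have h2 : TupleIn (tupleRight (Fin.init x.1.1)) (stab E x.1.2) := fun i => x.2.1 _
    have h3 := x.2.1 (Fin.last _)
    have hx := x.2.2
    rw [← commProd_init_mul_last, ← commProd_left_mul_right, ← lieExp_half] at hx
    have hb := lieExp_comm_of_mem_stab h3.2 (1 / 2 : ℝ)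
    refine ⟨h1, ?_, ?_, ?_, ?_, ?_⟩
    · rw [← conjTuple_mul, inv_inv, mul_one, mul_inv_cancel, conjTuple_one]
      exact h2.rev
    · rw [inv_inv]
      exact h3.1
    · rw [one_mul]
      exact h3.2
    · rw [lieExp_neg_half]
      group
    · rw [lieExp_neg_half, commProd_conj, commProd_rev]
      generalize lieExp ((1 / 2 : ℝ) • x.1.2) = e at *
      generalize commProd (tupleLeft (Fin.init x.1.1)) = m at *
      generalize commProd (tupleRight (Fin.init x.1.1)) = n at *
      generalize (x.1.1 (Fin.last _)).1 = a at *
      generalize (x.1.1 (Fin.last _)).2 = b at *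
      have hn : n = m⁻¹ * (e * e) * (a * b * a⁻¹ * b⁻¹)⁻¹ := by rw [← hx]; group
      -- The second product equation needs only that b commutes with exp(X/2).
      have hb' : e⁻¹ * b⁻¹ = b⁻¹ * e⁻¹ := by rw [← mul_inv_rev, ← mul_inv_rev, hb]
      calc a⁻¹ * n⁻¹ * a⁻¹⁻¹ = b * a⁻¹ * (b⁻¹ * e⁻¹) * e⁻¹ * m * a := by rw [hn]; group
        _ = b * a⁻¹ * e⁻¹ * b⁻¹ * (e⁻¹ * m * a) := by rw [← hb']; group⟩

theorem section₁_val (x : ymVariety E G (ℓ + ℓ)) :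
    (section₁ x).1 = (tupleLeft x.1.1, 1, revTuple (tupleRight x.1.1),
      lieExp ((-(1 / 2) : ℝ) • x.1.2) * commProd (tupleLeft x.1.1), x.1.2) := rfl

theorem section₂_val (x : ymVariety E G (ℓ + ℓ + 1)) :
    (section₂ x).1 = (tupleLeft (Fin.init x.1.1), (x.1.1 (Fin.last _)).1⁻¹, 1,
      conjTuple (x.1.1 (Fin.last _)).1⁻¹ (revTuple (tupleRight (Fin.init x.1.1))),
      lieExp ((-(1 / 2) : ℝ) • x.1.2) * commProd (tupleLeft (Fin.init x.1.1)) *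
        (x.1.1 (Fin.last _)).1, (x.1.1 (Fin.last _)).2, x.1.2) := rfl

theorem Phi₁_section₁ (x : ymVariety E G (ℓ + ℓ)) : Phi₁ ℓ (section₁ x) = x := by
  refine Subtype.ext ?_
  rw [Phi₁_val, section₁_val]
  refine Prod.ext ?_ rfl
  simp only [conjTuple_one, revTuple_revTuple, append_left_right]

theorem Phi₂_section₂ (x : ymVariety E G (ℓ + ℓ + 1)) : Phi₂ ℓ (section₂ x) = x := by
  refine Subtype.ext ?_
  rw [Phi₂_val, section₂_val]
  refine Prod.ext ?_ rfl
  simp only [inv_inv, mul_one, one_mul, ← conjTuple_rev, revTuple_revTuple, ← conjTuple_mul,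
    mul_inv_cancel, conjTuple_one, append_left_right, Prod.mk.eta, Fin.snoc_init_self]

theorem section₁_smul (g : G) (x : ymVariety E G (ℓ + ℓ)) :
    section₁ (g • x) = (g, g) • section₁ x := by
  refine Subtype.ext ?_
  rw [smul_zym₁_val, section₁_val, section₁_val, smul_ym_val]
  have h (V : Fin (ℓ + ℓ) → G × G) : tupleLeft (conjTuple g V) = conjTuple g (tupleLeft V) := rfl
  simp only [h, commProd_conj, ← map_smul, lieExp_Ad]
  refine Prod.ext rfl (Prod.ext ?_ (Prod.ext rfl (Prod.ext ?_ rfl)))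
  all_goals simp only; group

theorem section₂_smul (g : G) (x : ymVariety E G (ℓ + ℓ + 1)) :
    section₂ (g • x) = (g, g) • section₂ x := by
  refine Subtype.ext ?_
  rw [smul_zym₂_val, section₂_val, section₂_val, smul_ym_val]
  have h (V : Fin (ℓ + ℓ + 1) → G × G) :
      tupleLeft (Fin.init (conjTuple g V) : Fin (ℓ + ℓ) → G × G) =
        conjTuple g (tupleLeft (Fin.init V)) := rfl
  have h' (V : Fin (ℓ + ℓ + 1) → G × G) :
      revTuple (tupleRight (Fin.init (conjTuple g V) : Fin (ℓ + ℓ) → G × G)) =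
        conjTuple g (revTuple (tupleRight (Fin.init V))) := rfl
  have h'' (V : Fin (ℓ + ℓ + 1) → G × G) : conjTuple g V (Fin.last _) =
    (g * (V (Fin.last _)).1 * g⁻¹, g * (V (Fin.last _)).2 * g⁻¹) := rfl
  simp only [h, h', h'', commProd_conj, ← map_smul, lieExp_Ad, ← conjTuple_mul]
  refine Prod.ext rfl (Prod.ext ?_ (Prod.ext ?_ (Prod.ext ?_ (Prod.ext ?_ (Prod.ext rfl rfl)))))
  · simp only; group
  · simp only; group
  · simp only
    congr 1
    group
  · simp only; group

/-- The element (1, c⁻¹) turns the coordinate 1 back into c and undoes the conjugation in Φ. The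
coordinate c̄ comes out right because the first product equation determines it from V, c and X. -/
theorem eq_smul_section₁ (z : zymVariety₁ E G ℓ) :
    z = ((1, z.1.2.1⁻¹) : G × G) • section₁ (Phi₁ ℓ z) := by
  refine Subtype.ext ?_
  rw [smul_zym₁_val, section₁_val, Phi₁_val]
  have h := z.2.2.2.1
  refine Prod.ext ?_ (Prod.ext ?_ (Prod.ext ?_ (Prod.ext ?_ ?_)))
  · simp only [tupleLeft_append, conjTuple_one]
  · simp
  · simp only [tupleRight_append, ← conjTuple_rev, revTuple_revTuple, conjTuple_inv_conjTuple]
  · simp only [tupleLeft_append, lieExp_neg_half]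
    rw [show commProd z.1.1 = _ from h]
    group
  · simp [Ad_one]

/-- As for `eq_smul_section₁`, except that c̄ is recovered from the entry c c̄ of Φ, and the first
product equation recovers d̄. -/
theorem eq_smul_section₂ (z : zymVariety₂ E G ℓ) :
    z = ((1, z.1.2.2.1⁻¹) : G × G) • section₂ (Phi₂ ℓ z) := by
  refine Subtype.ext ?_
  rw [smul_zym₂_val, section₂_val, Phi₂_val]
  have h := z.2.2.2.2.2.1
  refine Prod.ext ?_ (Prod.ext ?_ (Prod.ext ?_ (Prod.ext ?_ (Prod.ext ?_ (Prod.ext ?_ ?_)))))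
  · simp only [Fin.init_snoc, tupleLeft_append, conjTuple_one]
  · simp
  · simp
  · simp only [Fin.init_snoc, Fin.snoc_last, tupleRight_append, ← conjTuple_rev,
      revTuple_revTuple, ← conjTuple_mul]
    rw [show z.1.2.2.1⁻¹ * (z.1.2.1⁻¹⁻¹ * (z.1.2.1⁻¹ * z.1.2.2.1)) = 1 by group, conjTuple_one]
  · simp only [Fin.init_snoc, Fin.snoc_last, tupleLeft_append, lieExp_neg_half]
    rw [show commProd z.1.1 = _ from h]
    group
  · simp
  · simp [Ad_one]

variable [FiniteDimensional ℝ E] [IsTopologicalGroup G]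

theorem continuous_section₁ : Continuous (section₁ : ymVariety E G (ℓ + ℓ) → _) := by
  refine continuous_induced_rng.2 ?_
  simp only [Function.comp_def, section₁_val]
  have h := continuous_subtype_val (p := (· ∈ ymVariety E G (ℓ + ℓ)))
  -- The image of the generator J_{-1/2} is exp(-X/2), the one factor whose continuity depends on
  -- that of exp.
  have he := continuous_genImage (E := E) (G := G) (k := ℓ + ℓ) (.J (-(1 / 2)))
  have hl := continuous_tupleLeft.comp h.fst
  exact hl.prodMk (continuous_const.prodMk
    ((continuous_revTuple.comp (continuous_tupleRight.comp h.fst)).prodMk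
    ((he.mul (continuous_commProd.comp hl)).prodMk h.snd)))

theorem continuous_section₂ : Continuous (section₂ : ymVariety E G (ℓ + ℓ + 1) → _) := by
  refine continuous_induced_rng.2 ?_
  simp only [Function.comp_def, section₂_val]
  have h := continuous_subtype_val (p := (· ∈ ymVariety E G (ℓ + ℓ + 1)))
  have he := continuous_genImage (E := E) (G := G) (k := ℓ + ℓ + 1) (.J (-(1 / 2)))
  have hi : Continuous fun x : ymVariety E G (ℓ + ℓ + 1) =>
      (Fin.init x.1.1 : Fin (ℓ + ℓ) → G × G) :=
    continuous_pi fun j => (continuous_apply (Fin.castSucc j)).comp h.fst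
  have hl := continuous_tupleLeft.comp hi
  have hp := (continuous_apply (Fin.last (ℓ + ℓ))).comp h.fst
  exact hl.prodMk (hp.fst.inv.prodMk (continuous_const.prodMk
    ((continuous_conjTuple hp.fst.inv
      (continuous_revTuple.comp (continuous_tupleRight.comp hi))).prodMk
    (((he.mul (continuous_commProd.comp hl)).mul hp.fst).prodMk (hp.snd.prodMk h.snd)))))

end Sections

end SurfaceYM

end

theorem mainTheorem3
    {E : Type*} [NormedAddCommGroup E] [NormedSpace ℝ E] [FiniteDimensional ℝ E] [CompleteSpace E]
    {G : Type*} [TopologicalSpace G] [T2Space G] [Group G] [IsTopologicalGroup G]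
    [ChartedSpace E G] [LieGroup 𝓘(ℝ, E) ∞ G] (ℓ : ℕ) :
    -- the case `i = 1`
    (Function.Surjective (Phi₁ (E := E) (G := G) ℓ) ∧
      (∃ f : MulAction.orbitRel.Quotient (G × G) (zymVariety₁ E G ℓ) ≃ₜ
          MulAction.orbitRel.Quotient G (ymVariety E G (ℓ + ℓ)),
        ∀ z : zymVariety₁ E G ℓ, f (Quotient.mk _ z) = Quotient.mk _ (Phi₁ ℓ z)) ∧
      (∃ h : MulAction.orbitRel.Quotient G (ymVariety E G (ℓ + ℓ)) ≃ₜ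
          MulAction.orbitRel.Quotient G (SurfHom (ℓ + ℓ) G),
        ∀ x : ymVariety E G (ℓ + ℓ), ∃ ρ : SurfHom (ℓ + ℓ) G,
          Corresponds x ρ ∧ h (Quotient.mk _ x) = Quotient.mk _ ρ) ∧
      (∃ e : ContinuousMap.HomotopyEquiv (HomotopyOrbit (G × G) (zymVariety₁ E G ℓ))
          (HomotopyOrbit G (ymVariety E G (ℓ + ℓ))),
        ∀ (a : MilnorE (G × G)) (z : zymVariety₁ E G ℓ),
          e (HomotopyOrbit.mk a z) = HomotopyOrbit.mk (a.map Prod.fst) (Phi₁ ℓ z))) ∧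
    -- the case `i = 2`
    (Function.Surjective (Phi₂ (E := E) (G := G) ℓ) ∧
      (∃ f : MulAction.orbitRel.Quotient (G × G) (zymVariety₂ E G ℓ) ≃ₜ
          MulAction.orbitRel.Quotient G (ymVariety E G (ℓ + ℓ + 1)),
        ∀ z : zymVariety₂ E G ℓ, f (Quotient.mk _ z) = Quotient.mk _ (Phi₂ ℓ z)) ∧
      (∃ h : MulAction.orbitRel.Quotient G (ymVariety E G (ℓ + ℓ + 1)) ≃ₜ
          MulAction.orbitRel.Quotient G (SurfHom (ℓ + ℓ + 1) G),
        ∀ x : ymVariety E G (ℓ + ℓ + 1), ∃ ρ : SurfHom (ℓ + ℓ + 1) G,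
          Corresponds x ρ ∧ h (Quotient.mk _ x) = Quotient.mk _ ρ) ∧
      (∃ e : ContinuousMap.HomotopyEquiv (HomotopyOrbit (G × G) (zymVariety₂ E G ℓ))
          (HomotopyOrbit G (ymVariety E G (ℓ + ℓ + 1))),
        ∀ (a : MilnorE (G × G)) (z : zymVariety₂ E G ℓ),
          e (HomotopyOrbit.mk a z) = HomotopyOrbit.mk (a.map Prod.fst) (Phi₂ ℓ z))) := by
  have hc₁ : Continuous fun z : zymVariety₁ E G ℓ => z.1.2.1 := continuous_subtype_val.snd.fst
  have hc₂ : Continuous fun z : zymVariety₂ E G ℓ => z.1.2.2.1 :=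
    continuous_subtype_val.snd.snd.fst
  exact ⟨⟨fun x => ⟨section₁ x, Phi₁_section₁ x⟩,
      exists_orbit_homeomorph continuous_Phi₁ continuous_section₁ Phi₁_section₁ Phi₁_smul
        section₁_smul eq_smul_section₁,
      exists_ymHom_homeomorph E G _,
      exists_homotopyEquiv continuous_Phi₁ continuous_section₁ hc₁ Phi₁_section₁ Phi₁_smul
        section₁_smul (fun _ _ => rfl) eq_smul_section₁⟩,
    ⟨fun x => ⟨section₂ x, Phi₂_section₂ x⟩,
      exists_orbit_homeomorph continuous_Phi₂ continuous_section₂ Phi₂_section₂ Phi₂_smul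
        section₂_smul eq_smul_section₂,
      exists_ymHom_homeomorph E G _,
      exists_homotopyEquiv continuous_Phi₂ continuous_section₂ hc₂ Phi₂_section₂ Phi₂_smul
        section₂_smul (fun _ _ => rfl) eq_smul_section₂⟩⟩
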